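/- Let $\overline{E(2)}$ be the projective covering group of the Euclidean group of the plane (the universal cover of the oscillator group): the set of triples $(s,a,\phi)$, $s\in\mathbb R$, $a=(a_x,a_y)\in\mathbb R^2$, $\phi\in\mathbb R$, with the topology of $\mathbb R^4$ and the multiplication $$(s,a,\phi)(s',a',\phi')=\bigl(s+s'+\tfrac12\,a\times R_\phi a',\ a+R_\phi a',\ \phi+\phi'\bigr),$$ where $a\times b=a_xb_y-a_yb_x$ and $R_\phi$ is the rotation by the angle $\phi$. Its one-parameter subgroups $(t,0,0)$, $(0,(t,0),0)$, $(0,(0,t),0)$, $(0,0,t)$ are generated by $E,P_1,P_2,J$, with $[P_1,P_2]=E$ central, $[J,P_1]=P_2$, $[J,P_2]=-P_1$. For a strongly continuous unitary representation $\pi$ of $\overline{E(2)}$, the generator of $\pi$ along a one-parameter subgroup $\gamma$ is the self-adjoint operator $A$ with $\pi(\gamma(t))=e^{-itA}$, that is, $A\psi=i\,\frac{d}{dt}\big|_{t=0}\pi(\gamma(t))\psi$ on the domain of all $\psi$ for which the derivative exists. Denote by $\hat E,\hat P_x,\hat P_y,\hat J$ the generators along the four subgroups above. Let $Q$ be the position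 operator, $(Q\psi)(x)=x\psi(x)$, with domain $\{\psi\in L^2(\mathbb R): x\psi\in L^2(\mathbb R)\}$, and let $P=-i\frac{d}{dx}$ be the momentum operator, with domain $\{\psi\in L^2(\mathbb R):\psi'\in L^2(\mathbb R)\}$ ($\psi'$ the weak derivative). **Theorem.** For each real $\mu\neq0$ there exists an irreducible strongly continuous unitary representation $\tilde\pi_\mu$ of $\overline{E(2)}$ on $L^2(\mathbb R)$ such that $$\hat E=\mu\,\mathbf 1,\qquad \hat P_x=\sqrt{|\mu|}\,Q,\qquad \hat P_y=\operatorname{sgn}(\mu)\sqrt{|\mu|}\,P,\qquad \hat J=-\operatorname{sgn}(\mu)\,\tfrac12\,(Q^2+P^2),$$ as equalities of unbounded operators, domains included, where $Q^2+P^2$ has the domain $D(Q^2)\cap D(P^2)$. -/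

import Mathlib

open MeasureTheory
open scoped ContDiff ENNReal

noncomputable section

/-! ### The projective covering group of the Euclidean group of the plane -/

/-- The group `Ē(2) = H(2) ⋊ ℝ` in its global coordinates `(s, a, φ)`, `a = (ax, ay) ∈ ℝ²`. -/
@[ext]
structure EBar where
  s : ℝ
  ax : ℝ
  ay : ℝ
  φ : ℝ

namespace EBar

/-- First coordinate of `R_φ (x, y)`, where `R_φ` is the rotation by the angle `φ`. -/
def rotX (φ x y : ℝ) : ℝ := Real.cos φ * x - Real.sin φ * y

/-- Second coordinate of `R_φ (x, y)`. -/
def rotY (φ x y : ℝ) : ℝ := Real.sin φ * x + Real.cos φ * y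

/-- `(s, a, φ) (s', a', φ') = (s + s' + ½ a × R_φ a', a + R_φ a', φ + φ')`,
where `a × b = a_x b_y - a_y b_x`. -/
instance : Mul EBar where
  mul g h :=
    { s := g.s + h.s + (1 / 2) * (g.ax * rotY g.φ h.ax h.ay - g.ay * rotX g.φ h.ax h.ay)
      ax := g.ax + rotX g.φ h.ax h.ay
      ay := g.ay + rotY g.φ h.ax h.ay
      φ := g.φ + h.φ }

instance : One EBar where
  one := { s := 0, ax := 0, ay := 0, φ := 0 }

/-- `(s, a, φ)⁻¹ = (-s, -R_{-φ} a, -φ)`. -/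
instance : Inv EBar where
  inv g :=
    { s := -g.s
      ax := -rotX (-g.φ) g.ax g.ay
      ay := -rotY (-g.φ) g.ax g.ay
      φ := -g.φ }

theorem mul_def (g h : EBar) : g * h =
    { s := g.s + h.s + (1 / 2) * (g.ax * rotY g.φ h.ax h.ay - g.ay * rotX g.φ h.ax h.ay)
      ax := g.ax + rotX g.φ h.ax h.ay
      ay := g.ay + rotY g.φ h.ax h.ay
      φ := g.φ + h.φ } := rfl

theorem one_def : (1 : EBar) = { s := 0, ax := 0, ay := 0, φ := 0 } := rfl

theorem inv_def (g : EBar) : g⁻¹ =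
    { s := -g.s
      ax := -rotX (-g.φ) g.ax g.ay
      ay := -rotY (-g.φ) g.ax g.ay
      φ := -g.φ } := rfl

instance : Group EBar :=
  Group.ofLeftAxioms
    (by
      intro g h k
      ext <;> simp only [mul_def, rotX, rotY, Real.cos_add, Real.sin_add]
      · linear_combination
          (1 / 2) * (h.ax * (Real.sin h.φ * k.ax + Real.cos h.φ * k.ay)
            - h.ay * (Real.cos h.φ * k.ax - Real.sin h.φ * k.ay)) * Real.sin_sq_add_cos_sq g.φ
      · ring
      · ring
      · ring)
    (by
      intro g
      ext <;> simp [mul_def, one_def, rotX, rotY])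
    (by
      intro g
      ext <;> simp [mul_def, one_def, inv_def, rotX, rotY]
      ring)

/-- The coordinates identify `Ē(2)` with `ℝ × (ℝ × ℝ) × ℝ`. -/
def coords : EBar ≃ ℝ × (ℝ × ℝ) × ℝ where
  toFun g := (g.s, (g.ax, g.ay), g.φ)
  invFun p := { s := p.1, ax := p.2.1.1, ay := p.2.1.2, φ := p.2.2 }
  left_inv _ := rfl
  right_inv _ := rfl

/-- The topology of `ℝ⁴`, through the global coordinates. -/
instance : TopologicalSpace EBar := TopologicalSpace.induced coords inferInstance

theorem continuous_coords : Continuous coords := continuous_induced_dom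

theorem continuous_s : Continuous EBar.s := continuous_fst.comp continuous_coords

theorem continuous_ax : Continuous EBar.ax :=
  (continuous_fst.comp (continuous_fst.comp continuous_snd)).comp continuous_coords

theorem continuous_ay : Continuous EBar.ay :=
  (continuous_snd.comp (continuous_fst.comp continuous_snd)).comp continuous_coords

theorem continuous_angle : Continuous EBar.φ :=
  (continuous_snd.comp continuous_snd).comp continuous_coords

instance : IsTopologicalGroup EBar where
  continuous_mul := by
    have h1 := continuous_s
    have h2 := continuous_ax
    have h3 := continuous_ay
    have h4 := continuous_angle
    refine continuous_induced_rng.2 ?_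
    change Continuous fun p : EBar × EBar => coords (p.1 * p.2)
    simp only [coords, mul_def, rotX, rotY, Equiv.coe_fn_mk]
    fun_prop
  continuous_inv := by
    have h1 := continuous_s
    have h2 := continuous_ax
    have h3 := continuous_ay
    have h4 := continuous_angle
    refine continuous_induced_rng.2 ?_
    change Continuous fun p : EBar => coords p⁻¹
    simp only [coords, inv_def, rotX, rotY, Equiv.coe_fn_mk]
    fun_prop

/-- The one-parameter subgroup `t ↦ exp (t E)`. -/
def expE (t : ℝ) : EBar := { s := t, ax := 0, ay := 0, φ := 0 }

/-- The one-parameter subgroup `t ↦ exp (t P₁)`. -/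
def expPx (t : ℝ) : EBar := { s := 0, ax := t, ay := 0, φ := 0 }

/-- The one-parameter subgroup `t ↦ exp (t P₂)`. -/
def expPy (t : ℝ) : EBar := { s := 0, ax := 0, ay := t, φ := 0 }

/-- The one-parameter subgroup `t ↦ exp (t J)`. -/
def expJ (t : ℝ) : EBar := { s := 0, ax := 0, ay := 0, φ := t }

end EBar

/-! ### Unitary representations and their generators -/

/-- A (strongly continuous) unitary representation of `G` on the Hilbert space `H`. -/
structure UnitaryRep (G : Type*) [Group G] [TopologicalSpace G]
    (H : Type*) [NormedAddCommGroup H] [InnerProductSpace ℂ H] [CompleteSpace H] where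
  toHom : G →* unitary (H →L[ℂ] H)
  continuous_apply : ∀ v : H, Continuous fun g => (toHom g : H →L[ℂ] H) v

namespace UnitaryRep

variable {G : Type*} [Group G] [TopologicalSpace G]
  {H : Type*} [NormedAddCommGroup H] [InnerProductSpace ℂ H] [CompleteSpace H]

/-- The operator `π g`. -/
def op (π : UnitaryRep G H) (g : G) : H →L[ℂ] H := (π.toHom g : H →L[ℂ] H)

/-- Irreducibility: the space is not zero, and its only closed invariant subspaces are `0` and the
whole space. -/
def IsIrreducible (π : UnitaryRep G H) : Prop :=
  Nontrivial H ∧ ∀ W : Submodule ℂ H, IsClosed (W : Set H) →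
    (∀ g, ∀ v ∈ W, π.op g v ∈ W) → W = ⊥ ∨ W = ⊤

end UnitaryRep

section Operators

variable {H : Type*} [NormedAddCommGroup H] [InnerProductSpace ℂ H]

/-- The generator `A` of a one-parameter family of operators `U t = e^{-itA}`, as an unbounded
operator with its full domain: `A v = i (d/dt) (U t v)` at `t = 0`, for all the vectors `v` at
which the derivative exists. -/
def generator (U : ℝ → H →L[ℂ] H) : H →ₗ.[ℂ] H where
  domain :=
    { carrier := {v | DifferentiableAt ℝ (fun t => U t v) 0}
      add_mem' := by
        intro v w hv hw
        simpa using DifferentiableAt.fun_add hv hw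
      zero_mem' := by simp
      smul_mem' := by
        intro c v hv
        simpa using DifferentiableAt.fun_const_smul (R := ℂ) hv c }
  toFun :=
    { toFun := fun v => Complex.I • deriv (fun t => U t (v : H)) 0
      map_add' := by
        rintro ⟨v, hv⟩ ⟨w, hw⟩
        have := deriv_fun_add (𝕜 := ℝ) (f := fun t => U t v) (g := fun t => U t w) hv hw
        simp only [Submodule.coe_add, map_add, this, smul_add]
      map_smul' := by
        rintro c ⟨v, hv⟩
        have := deriv_fun_const_smul (𝕜 := ℝ) (R := ℂ) (f := fun t => U t v) (x := 0) c hv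
        simp only [SetLike.val_smul, map_smul, this, RingHom.id_apply]
        rw [smul_comm] }

/-- The identity, as an everywhere defined operator. -/
def idOp : H →ₗ.[ℂ] H := (LinearMap.id : H →ₗ[ℂ] H).toPMap ⊤

/-- The product `A B` of unbounded operators, defined at the `v ∈ D(B)` with `B v ∈ D(A)`. -/
def opMul (A B : H →ₗ.[ℂ] H) : H →ₗ.[ℂ] H where
  domain :=
    { carrier := {v | ∃ h : v ∈ B.domain, B ⟨v, h⟩ ∈ A.domain}
      add_mem' := by
        rintro v w ⟨hv, hv'⟩ ⟨hw, hw'⟩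
        refine ⟨B.domain.add_mem hv hw, ?_⟩
        have := B.map_add ⟨v, hv⟩ ⟨w, hw⟩
        exact this ▸ A.domain.add_mem hv' hw'
      zero_mem' := by
        refine ⟨B.domain.zero_mem, ?_⟩
        have h : B ⟨0, B.domain.zero_mem⟩ = 0 := B.map_zero
        rw [h]
        exact A.domain.zero_mem
      smul_mem' := by
        rintro c v ⟨hv, hv'⟩
        refine ⟨B.domain.smul_mem c hv, ?_⟩
        have := B.map_smul c ⟨v, hv⟩
        exact this ▸ A.domain.smul_mem c hv' }
  toFun :=
    { toFun := fun v => A ⟨B ⟨v, v.2.1⟩, v.2.2⟩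
      map_add' := by
        rintro ⟨v, hv⟩ ⟨w, hw⟩
        rw [← A.map_add]
        congr 1
        exact Subtype.ext (B.map_add ⟨v, hv.1⟩ ⟨w, hw.1⟩)
      map_smul' := by
        rintro c ⟨v, hv⟩
        rw [RingHom.id_apply, ← A.map_smul]
        congr 1
        exact Subtype.ext (B.map_smul c ⟨v, hv.1⟩) }

end Operators

/-! ### Position and momentum on `L²(ℝ)` -/

/-- The Hilbert space `L²(ℝ)` of complex functions. -/
abbrev L2R : Type := Lp ℂ 2 (volume : Measure ℝ)

theorem mul_add_ae (v w : L2R) : (fun x : ℝ => (x : ℂ) * (v + w : L2R) x) =ᵐ[volume]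
    (fun x : ℝ => (x : ℂ) * v x) + fun x : ℝ => (x : ℂ) * w x := by
  filter_upwards [Lp.coeFn_add v w] with x hx
  simp only [hx, Pi.add_apply, mul_add]

theorem mul_smul_ae (c : ℂ) (v : L2R) : (fun x : ℝ => (x : ℂ) * (c • v : L2R) x) =ᵐ[volume]
    c • fun x : ℝ => (x : ℂ) * v x := by
  filter_upwards [Lp.coeFn_smul c v] with x hx
  simp only [hx, Pi.smul_apply, smul_eq_mul]
  ring

/-- The position operator `(Q ψ)(x) = x ψ(x)` on `{ψ ∈ L² | x ψ ∈ L²}`. -/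
def positionOp : L2R →ₗ.[ℂ] L2R where
  domain :=
    { carrier := {v | MemLp (fun x : ℝ => (x : ℂ) * v x) 2 volume}
      add_mem' := by
        intro v w hv hw
        exact (memLp_congr_ae (mul_add_ae v w)).2 (MemLp.add hv hw)
      zero_mem' := by
        have h : (fun x : ℝ => (x : ℂ) * (0 : L2R) x) =ᵐ[volume] 0 := by
          filter_upwards [Lp.coeFn_zero ℂ 2 (volume : Measure ℝ)] with x hx
          simp only [hx, Pi.zero_apply, mul_zero]
        exact (memLp_congr_ae h).2 MemLp.zero
      smul_mem' := by
        intro c v hv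
        exact (memLp_congr_ae (mul_smul_ae c v)).2 (MemLp.const_smul hv c) }
  toFun :=
    { toFun := fun v => MemLp.toLp (fun x : ℝ => (x : ℂ) * (v : L2R) x) v.2
      map_add' := by
        rintro ⟨v, hv⟩ ⟨w, hw⟩
        refine Lp.ext ?_
        filter_upwards [MemLp.coeFn_toLp hv, MemLp.coeFn_toLp hw,
          MemLp.coeFn_toLp ((memLp_congr_ae (mul_add_ae v w)).2 (MemLp.add hv hw)),
          Lp.coeFn_add (MemLp.toLp _ hv) (MemLp.toLp _ hw), mul_add_ae v w] with x h1 h2 h3 h4 h5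
        rw [h4, Pi.add_apply, h1, h2]
        exact h3.trans h5
      map_smul' := by
        rintro c ⟨v, hv⟩
        refine Lp.ext ?_
        filter_upwards [MemLp.coeFn_toLp hv,
          MemLp.coeFn_toLp ((memLp_congr_ae (mul_smul_ae c v)).2 (MemLp.const_smul hv c)),
          Lp.coeFn_smul c (MemLp.toLp _ hv), mul_smul_ae c v] with x h1 h3 h4 h5
        rw [RingHom.id_apply, h4, Pi.smul_apply, h1]
        exact h3.trans h5 }

/-- `w` is the weak derivative of `v`: `∫ g' v = -∫ g w` for all test functions `g`. -/
def IsWeakDeriv (v w : L2R) : Prop :=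
  ∀ g : ℝ → ℝ, ContDiff ℝ ∞ g → HasCompactSupport g →
    ∫ x, deriv g x • v x = -∫ x, g x • w x

theorem integrable_test_smul {g : ℝ → ℝ} (hg : Continuous g) (hc : HasCompactSupport g)
    (v : L2R) : Integrable (fun x => g x • v x) volume :=
  ((Lp.memLp v).locallyIntegrable (by norm_num)).integrable_smul_left_of_hasCompactSupport hg hc

theorem IsWeakDeriv.unique {v w w' : L2R} (h : IsWeakDeriv v w) (h' : IsWeakDeriv v w') :
    w = w' := by
  apply Lp.ext
  refine ae_eq_of_integral_contDiff_smul_eq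
    ((Lp.memLp w).locallyIntegrable (by norm_num))
    ((Lp.memLp w').locallyIntegrable (by norm_num)) ?_
  intro g hg hc
  exact neg_injective ((h g hg hc).symm.trans (h' g hg hc))

theorem integral_test_add {g : ℝ → ℝ} (hg : Continuous g) (hc : HasCompactSupport g)
    (v w : L2R) : ∫ x, g x • (v + w : L2R) x = (∫ x, g x • v x) + ∫ x, g x • w x := by
  rw [← integral_add (integrable_test_smul hg hc v) (integrable_test_smul hg hc w)]
  apply integral_congr_ae
  filter_upwards [Lp.coeFn_add v w] with x hx
  simp only [hx, Pi.add_apply, smul_add]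

theorem integral_test_smul (g : ℝ → ℝ) (c : ℂ) (v : L2R) :
    ∫ x, g x • (c • v : L2R) x = c • ∫ x, g x • v x := by
  rw [← integral_smul]
  apply integral_congr_ae
  filter_upwards [Lp.coeFn_smul c v] with x hx
  simp only [hx, Pi.smul_apply]
  rw [smul_comm]

theorem IsWeakDeriv.add {v w v' w' : L2R} (h : IsWeakDeriv v w) (h' : IsWeakDeriv v' w') :
    IsWeakDeriv (v + v') (w + w') := by
  intro g hg hc
  rw [integral_test_add (hg.continuous_deriv (by simp)) hc.deriv,
    integral_test_add hg.continuous hc, h g hg hc, h' g hg hc, neg_add]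

theorem IsWeakDeriv.smul (c : ℂ) {v w : L2R} (h : IsWeakDeriv v w) :
    IsWeakDeriv (c • v) (c • w) := by
  intro g hg hc
  rw [integral_test_smul, integral_test_smul, h g hg hc, smul_neg]

theorem IsWeakDeriv.zero : IsWeakDeriv 0 0 := by
  have h (g : ℝ → ℝ) : ∫ x, g x • (0 : L2R) x = 0 := by
    have := integral_test_smul g 0 0
    rwa [zero_smul, zero_smul] at this
  intro g _ _
  rw [h, h, neg_zero]

/-- The momentum operator `P ψ = -i dψ/dx` on `{ψ ∈ L² | ψ has a weak derivative in L²}`. -/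
def momentumOp : L2R →ₗ.[ℂ] L2R where
  domain :=
    { carrier := {v | ∃ w, IsWeakDeriv v w}
      add_mem' := by
        rintro v v' ⟨w, h⟩ ⟨w', h'⟩
        exact ⟨w + w', h.add h'⟩
      zero_mem' := ⟨0, IsWeakDeriv.zero⟩
      smul_mem' := by
        rintro c v ⟨w, h⟩
        exact ⟨c • w, h.smul c⟩ }
  toFun :=
    { toFun := fun v => (-Complex.I) • Classical.choose v.2
      map_add' := by
        intro v v'
        rw [← smul_add]
        congr 1
        exact (Classical.choose_spec (v + v').2).unique
          ((Classical.choose_spec v.2).add (Classical.choose_spec v'.2))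
      map_smul' := by
        intro c v
        rw [RingHom.id_apply, smul_comm]
        congr 1
        exact (Classical.choose_spec (c • v).2).unique ((Classical.choose_spec v.2).smul c) }

/-- The harmonic oscillator operator `(Q² + P²) / 2`, with domain `D(Q²) ∩ D(P²)`. -/
def oscillatorOp : L2R →ₗ.[ℂ] L2R :=
  (1 / 2 : ℂ) • (opMul positionOp positionOp + opMul momentumOp momentumOp)

end

/-!
Let `e z` be the Gaussian `exp (z x - x² / 2 - z² / 4)`. The inner product of `e w` and `e z` is
`√π exp (conj w * z / 2)`, and the `e z` span a dense subspace. Each element of `Ē(2)` acts on the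
labels by an affine map `z ↦ u z + α` with `|u| = 1`, and multiplying `e (u z + α)` by a suitable
scalar, exponential in `z`, preserves all inner products; hence the action extends to unitary
operators of `L²(ℝ)`.

The representation is irreducible because, in any invariant closed subspace, the projection of the
vacuum `e 0` is again fixed by the rotations up to the phase of `e 0`; pairing it with `e z` gives a
rotation-invariant entire function, which is constant, so the projection is a multiple of `e 0`. The
vacuum being cyclic, the subspace is trivial.

The span of the `e z` is invariant, so each generator is determined by its restriction to it, and it
remains to see that the symmetric operators `Q`, `P`, `Q² + P²` contain the closures of their
restrictions. For `Q` and `P` this is closedness; for the sum of squares it follows from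
`‖Q² f‖² + ‖P² f‖² ≤ ‖(Q² + P²) f‖² + 2 ‖f‖²`, a consequence of `[Q, P] = i`.
-/

noncomputable section

open Filter Topology

/-! ### Generators of one-parameter unitary groups -/

section UnboundedOperators

open scoped LinearPMap

variable {𝕜 E F : Type*} [RCLike 𝕜] [NormedAddCommGroup E] [InnerProductSpace 𝕜 E]
  [NormedAddCommGroup F] [InnerProductSpace 𝕜 F]

theorem mem_graph_domRestrict_iff {A : E →ₗ.[𝕜] F} {S : Submodule 𝕜 E} {v : E} {w : F} :
    (v, w) ∈ (A.domRestrict S).graph ↔ v ∈ S ∧ (v, w) ∈ A.graph := by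
  simp only [LinearPMap.mem_graph_iff]
  constructor
  · rintro ⟨y, rfl, rfl⟩
    exact ⟨y.2.1, ⟨y, y.2.2⟩, rfl, (LinearPMap.domRestrict_apply rfl).symm⟩
  · rintro ⟨hv, y, rfl, rfl⟩
    exact ⟨⟨y, hv, y.2⟩, rfl, LinearPMap.domRestrict_apply rfl⟩

theorem isFormalAdjoint_iff_graph {A : E →ₗ.[𝕜] F} {B : F →ₗ.[𝕜] E} :
    A.IsFormalAdjoint B ↔ ∀ v w, (v, w) ∈ A.graph → ∀ v' w', (v', w') ∈ B.graph →
      inner 𝕜 w v' = inner 𝕜 v w' := by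
  constructor
  · intro h v w hvw v' w' hvw'
    obtain ⟨x, rfl, rfl⟩ := (LinearPMap.mem_graph_iff A).1 hvw
    obtain ⟨y, rfl, rfl⟩ := (LinearPMap.mem_graph_iff B).1 hvw'
    exact h x y
  · exact fun h x y => h _ _ (A.mem_graph x) _ _ (B.mem_graph y)

theorem adjoint_adjoint_le_topologicalClosure [CompleteSpace E] [CompleteSpace F]
    (g : Submodule 𝕜 (E × F)) : g.adjoint.adjoint ≤ g.topologicalClosure := by
  intro p hp
  let e := WithLp.prodContinuousLinearEquiv 2 𝕜 E F
  let K : Submodule 𝕜 (WithLp 2 (E × F)) := g.comap (e : WithLp 2 (E × F) →ₗ[𝕜] E × F)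
  have hpK : e.symm p ∈ Kᗮᗮ := by
    intro y hy
    have hy' : ((e y).2, -(e y).1) ∈ g.adjoint := by
      rw [Submodule.mem_adjoint_iff]
      intro a b hab
      have := hy (e.symm (a, b)) (by simpa [K] using hab)
      simpa [WithLp.prod_inner_apply, e, add_comm] using this
    have := (Submodule.mem_adjoint_iff _ _).1 hp _ _ hy'
    rw [inner_neg_left, ← neg_add', neg_eq_zero] at this
    simpa [WithLp.prod_inner_apply, e] using this
  rw [Submodule.orthogonal_orthogonal_eq_closure] at hpK
  have := map_mem_closure (t := (g : Set (E × F))) e.continuous hpK fun x hx => hx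
  rwa [e.apply_symm_apply] at this

theorem adjoint_anti [CompleteSpace E] {A B : E →ₗ.[𝕜] F} (hA : Dense (A.domain : Set E))
    (hAB : A ≤ B) : B† ≤ A† := by
  refine LinearPMap.le_of_le_graph ?_
  rw [LinearPMap.adjoint_graph_eq_graph_adjoint hA,
    LinearPMap.adjoint_graph_eq_graph_adjoint (hA.mono hAB.1)]
  intro x hx
  rw [Submodule.mem_adjoint_iff] at hx ⊢
  exact fun a b hab => hx a b (LinearPMap.le_graph_of_le hAB hab)

end UnboundedOperators

section OneParameterGroups

open scoped LinearPMap

variable {H : Type*} [NormedAddCommGroup H] [InnerProductSpace ℂ H]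

/-- Strongly continuous one-parameter groups of isometries, hence of unitary operators since
`U (-t)` inverts `U t`. -/
structure IsOneParameterUnitaryGroup (U : ℝ → H →L[ℂ] H) : Prop where
  map_zero : U 0 = 1
  map_add_apply : ∀ s t v, U (s + t) v = U s (U t v)
  inner_map_map : ∀ t v w, inner ℂ (U t v) (U t w) = inner ℂ v w
  continuous_apply : ∀ v, Continuous fun t => U t v

theorem mem_generator_graph {U : ℝ → H →L[ℂ] H} {v w : H} :
    (v, w) ∈ (generator U).graph ↔ HasDerivAt (fun t => U t v) (-Complex.I • w) 0 := by
  rw [LinearPMap.mem_graph_iff]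
  constructor
  · rintro ⟨⟨y, hy⟩, rfl, h⟩
    have hy' : DifferentiableAt ℝ (fun t => U t y) 0 := hy
    have h' : Complex.I • deriv (fun t => U t y) 0 = w := h
    simpa [← h', smul_smul] using hy'.hasDerivAt
  · intro h
    refine ⟨⟨v, h.differentiableAt⟩, rfl, ?_⟩
    change Complex.I • deriv (fun t => U t v) 0 = w
    simp [h.deriv, smul_smul]

namespace IsOneParameterUnitaryGroup

variable {U : ℝ → H →L[ℂ] H} (hU : IsOneParameterUnitaryGroup U)
include hU

theorem apply_apply_neg (t : ℝ) (v : H) : U t (U (-t) v) = v := by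
  rw [← hU.map_add_apply, add_neg_cancel, hU.map_zero, one_apply_eq_self]

theorem inner_apply_right (t : ℝ) (v w : H) : inner ℂ v (U t w) = inner ℂ (U (-t) v) w := by
  conv_lhs => rw [← hU.apply_apply_neg t v]
  rw [hU.inner_map_map]

theorem hasDerivAt {v w : H} (h : (v, w) ∈ (generator U).graph) (t : ℝ) :
    HasDerivAt (fun s => U s v) (-Complex.I • U t w) t := by
  have h0 : HasDerivAt (fun s => U s v) (-Complex.I • w) (-t + t) := by
    simpa using mem_generator_graph.1 h
  have h1 := ((U t).restrictScalars ℝ).hasFDerivAt.comp_hasDerivAt t (h0.comp_const_add (-t) t)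
  simpa [Function.comp_def, ← hU.map_add_apply] using h1

theorem apply_mem_graph {v w : H} (h : (v, w) ∈ (generator U).graph) (t : ℝ) :
    (U t v, U t w) ∈ (generator U).graph := by
  rw [mem_generator_graph]
  have h1 : HasDerivAt (fun s => U (s + t) v) (-Complex.I • U t w) 0 :=
    HasDerivAt.comp_add_const 0 t (by simpa only [zero_add] using hU.hasDerivAt h t)
  simpa only [hU.map_add_apply] using h1

theorem isFormalAdjoint_generator : (generator U).IsFormalAdjoint (generator U) := by
  refine isFormalAdjoint_iff_graph.2 fun v w h v' w' h' => ?_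
  have hconst : (fun t => inner ℂ (U t v) (U t v')) = fun _ => inner ℂ v v' :=
    funext fun t => hU.inner_map_map t v v'
  have hderiv := (mem_generator_graph.1 h).inner ℂ (mem_generator_graph.1 h')
  rw [hconst] at hderiv
  have h0 := hderiv.unique (hasDerivAt_const _ _)
  simp only [hU.map_zero, one_apply_eq_self, inner_smul_left, inner_smul_right, map_neg,
    Complex.conj_I, neg_neg] at h0
  refine mul_left_cancel₀ Complex.I_ne_zero ?_
  linear_combination h0

section Core

variable {S : Submodule ℂ H} (hinv : ∀ v ∈ S, ∀ t, U t v ∈ S) (hdom : S ≤ (generator U).domain)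
  {v w : H}
  (hweak : ∀ g ∈ S, ∀ g', (g, g') ∈ (generator U).graph → inner ℂ g' v = inner ℂ g w)
include hinv hdom hweak

theorem hasDerivAt_inner_apply {g : H} (hg : g ∈ S) (t : ℝ) :
    HasDerivAt (fun s => inner ℂ g (U s v)) (inner ℂ g (-Complex.I • U t w)) t := by
  obtain ⟨g', hg'⟩ := LinearPMap.mem_domain_iff.1 (hdom hg)
  have hderiv := ((hU.hasDerivAt hg' (-t)).scomp t (hasDerivAt_neg t)).inner ℂ
    (hasDerivAt_const t v)
  simp only [Function.comp_apply, ← hU.inner_apply_right] at hderiv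
  refine hderiv.congr_deriv ?_
  simp only [inner_zero_right, zero_add, neg_smul, one_smul, neg_neg, inner_smul_left,
    Complex.conj_I, hweak _ (hinv g hg (-t)) _ (hU.apply_mem_graph hg' (-t)), inner_smul_right,
    inner_neg_right, hU.inner_apply_right]
  ring

theorem apply_eq_add_integral [CompleteSpace H] (hS : Dense (S : Set H)) (t : ℝ) :
    U t v = v + ∫ s in (0 : ℝ)..t, -Complex.I • U s w := by
  have hc : Continuous fun t => -Complex.I • U t w := (hU.continuous_apply w).const_smul _
  rw [← sub_eq_zero]
  refine hS.eq_zero_of_inner_right ℂ fun g hg => ?_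
  have hderiv : ∀ t, HasDerivAt (fun t => inner ℂ g
      (U t v - (v + ∫ s in (0 : ℝ)..t, -Complex.I • U s w))) 0 t := by
    intro t
    simp only [inner_sub_right, inner_add_right]
    have hint := (hasDerivAt_const t g).inner ℂ (hc.integral_hasStrictDerivAt 0 t).hasDerivAt
    refine ((hU.hasDerivAt_inner_apply hinv hdom hweak hg t).sub
      (hint.const_add (inner ℂ g v))).congr_deriv (by simp)
  rw [is_const_of_deriv_eq_zero (fun t => (hderiv t).differentiableAt)
    (fun t => (hderiv t).deriv) t 0]
  simp [hU.map_zero]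

-- Integrating the weak derivative of the orbit gives the strong one.
theorem mem_generator_graph_of_inner [CompleteSpace H] (hS : Dense (S : Set H)) :
    (v, w) ∈ (generator U).graph := by
  have hc : Continuous fun t => -Complex.I • U t w := (hU.continuous_apply w).const_smul _
  rw [mem_generator_graph]
  have hint := ((hc.integral_hasStrictDerivAt 0 0).hasDerivAt).const_add v
  simp only [← hU.apply_eq_add_integral hinv hdom hweak hS] at hint
  simpa [hU.map_zero] using hint

end Core

section Core

variable {S : Submodule ℂ H} (hS : Dense (S : Set H))
  (hinv : ∀ v ∈ S, ∀ t, U t v ∈ S) (hdom : S ≤ (generator U).domain)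
include hS hdom

omit hU in
theorem dense_domRestrict_domain : Dense (((generator U).domRestrict S).domain : Set H) := by
  rwa [LinearPMap.domRestrict_domain, inf_eq_left.2 hdom]

variable [CompleteSpace H]
include hinv

theorem adjoint_domRestrict_generator_le : ((generator U).domRestrict S)† ≤ generator U := by
  have hd := dense_domRestrict_domain hS hdom
  refine LinearPMap.le_of_le_graph fun ⟨v, w⟩ hvw => ?_
  rw [LinearPMap.adjoint_graph_eq_graph_adjoint hd, Submodule.mem_adjoint_iff] at hvw
  exact hU.mem_generator_graph_of_inner hinv hdom
    (fun g hg g' hg' => sub_eq_zero.1 (hvw g g' (mem_graph_domRestrict_iff.2 ⟨hg, hg'⟩))) hS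

theorem adjoint_domRestrict_generator : ((generator U).domRestrict S)† = generator U :=
  (hU.adjoint_domRestrict_generator_le hS hinv hdom).antisymm <|
    (hU.isFormalAdjoint_generator.le_adjoint (hS.mono hdom)).trans
      (adjoint_anti (dense_domRestrict_domain hS hdom) LinearPMap.domRestrict_le)

theorem graph_generator_le_topologicalClosure :
    (generator U).graph ≤ ((generator U).domRestrict S).graph.topologicalClosure := by
  set A := (generator U).domRestrict S
  have hd : Dense (A.domain : Set H) := dense_domRestrict_domain hS hdom
  have hadj : A† = generator U := hU.adjoint_domRestrict_generator hS hinv hdom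
  have hd' : Dense (A†.domain : Set H) := hadj ▸ hS.mono hdom
  calc (generator U).graph ≤ (generator U)†.graph :=
        LinearPMap.le_graph_of_le (hU.isFormalAdjoint_generator.le_adjoint (hS.mono hdom))
    _ = A.graph.adjoint.adjoint := by
      rw [← hadj, LinearPMap.adjoint_graph_eq_graph_adjoint hd',
        LinearPMap.adjoint_graph_eq_graph_adjoint hd]
    _ ≤ A.graph.topologicalClosure := adjoint_adjoint_le_topologicalClosure _

end Core

theorem generator_eq_of_core [CompleteSpace H] {B : H →ₗ.[ℂ] H} {S : Submodule ℂ H}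
    (hS : Dense (S : Set H)) (hinv : ∀ v ∈ S, ∀ t, U t v ∈ S)
    (hB : ∀ v ∈ S, ∃ w, (v, w) ∈ B.graph ∧ (v, w) ∈ (generator U).graph)
    (hsymm : (B.domRestrict S).IsFormalAdjoint B)
    (hclosure : (B.domRestrict S).graph.topologicalClosure ≤ B.graph) :
    generator U = B := by
  have hdom : S ≤ (generator U).domain := fun v hv =>
    LinearPMap.mem_domain_of_mem_graph (hB v hv).choose_spec.2
  have hrestr : (generator U).domRestrict S = B.domRestrict S := by
    refine LinearPMap.eq_of_eq_graph (Submodule.ext fun ⟨v, w⟩ => ?_)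
    simp only [mem_graph_domRestrict_iff, and_congr_right_iff]
    intro hv
    obtain ⟨w', hw', hw''⟩ := hB v hv
    exact ⟨fun h => LinearPMap.mem_graph_snd_inj _ hw'' h rfl ▸ hw',
      fun h => LinearPMap.mem_graph_snd_inj _ hw' h rfl ▸ hw''⟩
  have hd : Dense ((B.domRestrict S).domain : Set H) :=
    hrestr ▸ dense_domRestrict_domain hS hdom
  refine le_antisymm ?_ ?_
  · refine LinearPMap.le_of_le_graph ?_
    exact ((hU.graph_generator_le_topologicalClosure hS hinv hdom).trans_eq (by rw [hrestr])).trans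
      hclosure
  · rw [← hU.adjoint_domRestrict_generator hS hinv hdom, hrestr]
    exact hsymm.le_adjoint hd

end IsOneParameterUnitaryGroup

end OneParameterGroups

section GraphLemmas

theorem mem_graph_smul_iff {𝕜 E F : Type*} [Field 𝕜] [AddCommGroup E] [Module 𝕜 E]
    [AddCommGroup F] [Module 𝕜 F] {A : E →ₗ.[𝕜] F} {c : 𝕜} (hc : c ≠ 0) {v : E} {w : F} :
    (v, w) ∈ (c • A).graph ↔ (v, c⁻¹ • w) ∈ A.graph := by
  simp only [LinearPMap.mem_graph_iff]
  refine exists_congr fun y => and_congr_right fun _ => ?_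
  rw [LinearPMap.smul_apply, eq_inv_smul_iff₀ hc]

theorem exists_mem_of_mem_span {R M N : Type*} [Semiring R] [AddCommMonoid M] [Module R M]
    [AddCommMonoid N] [Module R N] {s : Set M} {g : Submodule R (M × N)}
    (h : ∀ v ∈ s, ∃ w, (v, w) ∈ g) {v : M} (hv : v ∈ Submodule.span R s) : ∃ w, (v, w) ∈ g := by
  have hle : Submodule.span R s ≤ g.map (LinearMap.fst R M N) := Submodule.span_le.2 fun v hv =>
    let ⟨w, hw⟩ := h v hv
    ⟨(v, w), hw, rfl⟩
  obtain ⟨⟨_, w⟩, hw, rfl⟩ := hle hv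
  exact ⟨w, hw⟩

variable {𝕜 E F : Type*} [RCLike 𝕜] [NormedAddCommGroup E] [InnerProductSpace 𝕜 E]
  [NormedAddCommGroup F] [InnerProductSpace 𝕜 F]

theorem isFormalAdjoint_mono_left {A A' : E →ₗ.[𝕜] F} {B : F →ₗ.[𝕜] E} (hA : A' ≤ A)
    (h : A.IsFormalAdjoint B) : A'.IsFormalAdjoint B :=
  isFormalAdjoint_iff_graph.2 fun _ _ hv =>
    isFormalAdjoint_iff_graph.1 h _ _ (LinearPMap.le_graph_of_le hA hv)

theorem isFormalAdjoint_smul {A : E →ₗ.[𝕜] F} {B : F →ₗ.[𝕜] E} {c : 𝕜}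
    (h : A.IsFormalAdjoint B) : (c • A).IsFormalAdjoint (starRingEnd 𝕜 c • B) := fun x y => by
  rw [LinearPMap.smul_apply, LinearPMap.smul_apply, inner_smul_left, inner_smul_right, h x y]

theorem isFormalAdjoint_domRestrict_span {A : E →ₗ.[𝕜] F} {B : F →ₗ.[𝕜] E} {s : Set E}
    (h : ∀ v ∈ s, ∃ w, (v, w) ∈ A.graph ∧
      ∀ v' w', (v', w') ∈ B.graph → inner 𝕜 w v' = inner 𝕜 v w') :
    (A.domRestrict (Submodule.span 𝕜 s)).IsFormalAdjoint B := by
  refine isFormalAdjoint_iff_graph.2 fun v w hvw v' w' hvw' => ?_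
  obtain ⟨hv, hvw⟩ := mem_graph_domRestrict_iff.1 hvw
  obtain ⟨u, hu, hu'⟩ := exists_mem_of_mem_span (g := A.graph ⊓ B.graph.adjoint) (fun v hv => by
    obtain ⟨w, hw, hw'⟩ := h v hv
    refine ⟨w, hw, (Submodule.mem_adjoint_iff _ _).2 fun a b hab => ?_⟩
    rw [← inner_conj_symm b, ← inner_conj_symm a, hw' a b hab, sub_self]) hv
  obtain rfl := LinearPMap.mem_graph_snd_inj _ hu hvw rfl
  have := sub_eq_zero.1 ((Submodule.mem_adjoint_iff _ _).1 hu' v' w' hvw')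
  rw [← inner_conj_symm, ← this, inner_conj_symm]

theorem topologicalClosure_graph_domRestrict_le {A : E →ₗ.[𝕜] F} (hA : A.IsClosed)
    (S : Submodule 𝕜 E) : (A.domRestrict S).graph.topologicalClosure ≤ A.graph :=
  Submodule.topologicalClosure_minimal _ (LinearPMap.le_graph_of_le LinearPMap.domRestrict_le) hA

theorem topologicalClosure_graph_smul_le {A B : E →ₗ.[𝕜] F} {c : 𝕜} (hc : c ≠ 0)
    (h : A.graph.topologicalClosure ≤ B.graph) :
    (c • A).graph.topologicalClosure ≤ (c • B).graph := by
  intro p hp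
  refine (mem_graph_smul_iff hc).2 (h ?_)
  exact map_mem_closure (f := fun p : E × F => (p.1, c⁻¹ • p.2)) (by fun_prop) hp
    fun q hq => (mem_graph_smul_iff hc).1 hq

theorem domRestrict_smul {A : E →ₗ.[𝕜] F} {c : 𝕜} (S : Submodule 𝕜 E) :
    (c • A).domRestrict S = c • A.domRestrict S :=
  rfl

theorem IsOneParameterUnitaryGroup.generator_eq_smul_of_span {H : Type*} [NormedAddCommGroup H]
    [InnerProductSpace ℂ H] [CompleteSpace H] {U : ℝ → H →L[ℂ] H}
    (hU : IsOneParameterUnitaryGroup U) {A : H →ₗ.[ℂ] H} {c : ℝ} (hc : c ≠ 0) {s : Set H}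
    (hs : Dense (Submodule.span ℂ s : Set H))
    (hinv : ∀ v ∈ Submodule.span ℂ s, ∀ t, U t v ∈ Submodule.span ℂ s)
    (hA : ∀ v ∈ s, ∃ w, (v, w) ∈ A.graph ∧ (v, (c : ℂ) • w) ∈ (generator U).graph)
    (hsymm : (A.domRestrict (Submodule.span ℂ s)).IsFormalAdjoint A)
    (hclosure : (A.domRestrict (Submodule.span ℂ s)).graph.topologicalClosure ≤ A.graph) :
    generator U = (c : ℂ) • A := by
  have hc' : (c : ℂ) ≠ 0 := Complex.ofReal_ne_zero.2 hc
  refine hU.generator_eq_of_core hs hinv (fun v hv => ?_) ?_ ?_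
  · refine exists_mem_of_mem_span (g := ((c : ℂ) • A).graph ⊓ (generator U).graph)
      (fun v hv => ?_) hv
    obtain ⟨w, hw, hgen⟩ := hA v hv
    exact ⟨(c : ℂ) • w, (mem_graph_smul_iff hc').2 (by rwa [inv_smul_smul₀ hc']), hgen⟩
  · simpa only [domRestrict_smul, Complex.conj_ofReal] using
      isFormalAdjoint_smul (c := (c : ℂ)) hsymm
  · rw [domRestrict_smul]
    exact topologicalClosure_graph_smul_le hc' hclosure

theorem mem_idOp_graph {H : Type*} [NormedAddCommGroup H] [InnerProductSpace ℂ H] {v w : H} :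
    (v, w) ∈ (idOp : H →ₗ.[ℂ] H).graph ↔ v = w := by
  simp [idOp, LinearPMap.mem_graph_iff]

theorem isFormalAdjoint_idOp {H : Type*} [NormedAddCommGroup H] [InnerProductSpace ℂ H] :
    (idOp : H →ₗ.[ℂ] H).IsFormalAdjoint idOp :=
  fun _ _ => rfl

theorem isClosed_idOp {H : Type*} [NormedAddCommGroup H] [InnerProductSpace ℂ H] :
    (idOp : H →ₗ.[ℂ] H).IsClosed := by
  have : ((idOp : H →ₗ.[ℂ] H).graph : Set (H × H)) = {p | p.1 = p.2} :=
    Set.ext fun _ => mem_idOp_graph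
  rw [LinearPMap.IsClosed, this]
  exact isClosed_eq continuous_fst continuous_snd

end GraphLemmas

/-! ### Sums of squares of canonically conjugate operators -/

section SumOfSquares

theorem mem_graph_opMul_iff {H : Type*} [NormedAddCommGroup H] [InnerProductSpace ℂ H]
    {A B : H →ₗ.[ℂ] H} {v w : H} :
    (v, w) ∈ (opMul A B).graph ↔ ∃ u, (v, u) ∈ B.graph ∧ (u, w) ∈ A.graph := by
  constructor
  · intro h
    obtain ⟨⟨y, hy, hy'⟩, rfl, rfl⟩ := (LinearPMap.mem_graph_iff _).1 h
    exact ⟨B ⟨y, hy⟩, LinearPMap.mem_graph B ⟨y, hy⟩, LinearPMap.mem_graph A ⟨B ⟨y, hy⟩, hy'⟩⟩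
  · rintro ⟨u, hu, hw⟩
    have hv := LinearPMap.mem_domain_of_mem_graph hu
    obtain rfl := (LinearPMap.image_iff hv).2 hu
    have hv' := LinearPMap.mem_domain_of_mem_graph hw
    obtain rfl := (LinearPMap.image_iff hv').2 hw
    exact LinearPMap.mem_graph (opMul A B) ⟨v, hv, hv'⟩

theorem mem_graph_add_iff {R E F : Type*} [Ring R] [AddCommGroup E] [Module R E]
    [AddCommGroup F] [Module R F] {A B : E →ₗ.[R] F} {v : E} {w : F} :
    (v, w) ∈ (A + B).graph ↔ ∃ a b, (v, a) ∈ A.graph ∧ (v, b) ∈ B.graph ∧ a + b = w := by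
  constructor
  · intro h
    obtain ⟨⟨y, hy⟩, rfl, rfl⟩ := (LinearPMap.mem_graph_iff _).1 h
    exact ⟨A ⟨y, hy.1⟩, B ⟨y, hy.2⟩, LinearPMap.mem_graph A ⟨y, hy.1⟩,
      LinearPMap.mem_graph B ⟨y, hy.2⟩, rfl⟩
  · rintro ⟨a, b, ha, hb, rfl⟩
    have hvA := LinearPMap.mem_domain_of_mem_graph ha
    have hvB := LinearPMap.mem_domain_of_mem_graph hb
    obtain rfl := (LinearPMap.image_iff hvA).2 ha
    obtain rfl := (LinearPMap.image_iff hvB).2 hb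
    exact LinearPMap.mem_graph (A + B) ⟨v, hvA, hvB⟩

theorem isFormalAdjoint_add {𝕜 E F : Type*} [RCLike 𝕜] [NormedAddCommGroup E]
    [InnerProductSpace 𝕜 E] [NormedAddCommGroup F] [InnerProductSpace 𝕜 F]
    {A A' : E →ₗ.[𝕜] F} {B B' : F →ₗ.[𝕜] E} (h : A.IsFormalAdjoint B)
    (h' : A'.IsFormalAdjoint B') : (A + A').IsFormalAdjoint (B + B') := fun x y => by
  rw [LinearPMap.add_apply, LinearPMap.add_apply, inner_add_left, inner_add_right]
  exact congrArg₂ (· + ·) (h ⟨x, x.2.1⟩ ⟨y, y.2.1⟩) (h' ⟨x, x.2.2⟩ ⟨y, y.2.2⟩)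

theorem cauchySeq_comp_of_norm_le {E F G : Type*} [AddGroup E] [SeminormedAddCommGroup F]
    [SeminormedAddCommGroup G] {a : E →+ F} {b : E →+ G} {K : ℝ} (h : ∀ x, ‖a x‖ ≤ K * ‖b x‖)
    {u : ℕ → E} (hb : CauchySeq (b ∘ u)) : CauchySeq (a ∘ u) := by
  rw [cauchySeq_iff_tendsto_dist_atTop_0] at hb ⊢
  refine squeeze_zero (fun _ => dist_nonneg) (fun n => ?_) (by simpa using hb.const_mul K)
  simpa only [Function.comp_apply, dist_eq_norm, map_sub] using h (u n.1 - u n.2)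

theorem isSymmetric_norm_le {𝕜 E : Type*} [RCLike 𝕜] [SeminormedAddCommGroup E]
    [InnerProductSpace 𝕜 E] {T : E →ₗ[𝕜] E} (hT : T.IsSymmetric) (f : E) :
    ‖T f‖ ≤ ‖f‖ + ‖T (T f)‖ := by
  have hsq : ‖T f‖ ^ 2 ≤ ‖f‖ * ‖T (T f)‖ := by
    rw [← inner_self_eq_norm_sq (𝕜 := 𝕜), hT]
    exact (RCLike.re_le_norm _).trans (norm_inner_le_norm _ _)
  refine le_of_sq_le_sq ?_ (by positivity)
  nlinarith [norm_nonneg f, norm_nonneg (T (T f))]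

section CanonicalCommutation

variable {E : Type*} [SeminormedAddCommGroup E] [InnerProductSpace ℂ E] {q p : E →ₗ[ℂ] E}

theorem im_inner_of_commutator (hq : q.IsSymmetric) (hp : p.IsSymmetric)
    (hcomm : ∀ f, p (q f) = q (p f) - Complex.I • f) (f : E) :
    2 * (inner ℂ (q f) (p f)).im = ‖f‖ ^ 2 := by
  have h : inner ℂ (q f) (p f) - inner ℂ (p f) (q f) = Complex.I * inner ℂ f f := by
    rw [hq, hp, hcomm, inner_sub_right, inner_smul_right, sub_sub_cancel]
  have him := congrArg Complex.im h
  rw [← inner_conj_symm (p f), inner_self_eq_norm_sq_to_K, Complex.sub_im, Complex.conj_im] at him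
  simp only [← Complex.ofReal_pow, Complex.coe_algebraMap, Complex.I_mul_im,
    Complex.ofReal_re] at him
  linarith

theorem re_inner_sq_sq_of_commutator (hq : q.IsSymmetric) (hp : p.IsSymmetric)
    (hcomm : ∀ f, p (q f) = q (p f) - Complex.I • f) (f : E) :
    (inner ℂ (q (q f)) (p (p f))).re = ‖q (p f)‖ ^ 2 - ‖f‖ ^ 2 := by
  have hpqq : p (q (q f)) = q (q (p f)) - (2 * Complex.I) • q f := by
    simp only [hcomm, map_sub, map_smul, two_mul, add_smul]
    abel
  have h : inner ℂ (q (q f)) (p (p f)) =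
      inner ℂ (q (p f)) (q (p f)) + 2 * Complex.I * inner ℂ (q f) (p f) := by
    rw [← hp, hpqq, inner_sub_left, inner_smul_left, hq, map_mul, Complex.conj_I,
      Complex.conj_ofNat]
    ring
  have him := im_inner_of_commutator hq hp hcomm f
  have hre : (inner ℂ (q (p f)) (q (p f))).re = ‖q (p f)‖ ^ 2 :=
    inner_self_eq_norm_sq (𝕜 := ℂ) _
  rw [h, Complex.add_re, hre, mul_assoc, mul_left_comm, Complex.I_mul_re]
  simp only [Complex.mul_im, Complex.re_ofNat, Complex.im_ofNat]
  linarith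

theorem norm_sq_add_norm_sq_le_of_commutator (hq : q.IsSymmetric) (hp : p.IsSymmetric)
    (hcomm : ∀ f, p (q f) = q (p f) - Complex.I • f) (f : E) :
    ‖q (q f)‖ ^ 2 + ‖p (p f)‖ ^ 2 ≤ ‖q (q f) + p (p f)‖ ^ 2 + 2 * ‖f‖ ^ 2 := by
  have h := norm_add_sq (𝕜 := ℂ) (q (q f)) (p (p f))
  rw [RCLike.re_eq_complex_re, re_inner_sq_sq_of_commutator hq hp hcomm] at h
  linarith [sq_nonneg ‖q (p f)‖]

theorem norm_le_mul_norm_prod_of_commutator (hq : q.IsSymmetric) (hp : p.IsSymmetric)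
    (hcomm : ∀ f, p (q f) = q (p f) - Complex.I • f) (f : E) :
    (‖q f‖ ≤ 3 * ‖(f, q (q f) + p (p f))‖ ∧ ‖q (q f)‖ ≤ 3 * ‖(f, q (q f) + p (p f))‖) ∧
      ‖p f‖ ≤ 3 * ‖(f, q (q f) + p (p f))‖ ∧ ‖p (p f)‖ ≤ 3 * ‖(f, q (q f) + p (p f))‖ := by
  have hsq := norm_sq_add_norm_sq_le_of_commutator hq hp hcomm f
  have hfst : ‖f‖ ≤ ‖(f, q (q f) + p (p f))‖ := norm_fst_le (f, q (q f) + p (p f))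
  have hsnd : ‖q (q f) + p (p f)‖ ≤ ‖(f, q (q f) + p (p f))‖ := norm_snd_le (f, q (q f) + p (p f))
  set r := ‖(f, q (q f) + p (p f))‖
  have hr : 0 ≤ r := norm_nonneg _
  have hsum : ‖q (q f)‖ ^ 2 + ‖p (p f)‖ ^ 2 ≤ (2 * r) ^ 2 := by
    linarith [pow_le_pow_left₀ (norm_nonneg _) hfst 2, pow_le_pow_left₀ (norm_nonneg _) hsnd 2,
      sq_nonneg r]
  have hqq : ‖q (q f)‖ ≤ 2 * r :=
    le_of_sq_le_sq (by linarith [sq_nonneg ‖p (p f)‖]) (by positivity)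
  have hpp : ‖p (p f)‖ ≤ 2 * r :=
    le_of_sq_le_sq (by linarith [sq_nonneg ‖q (q f)‖]) (by positivity)
  have hqf := isSymmetric_norm_le hq f
  have hpf := isSymmetric_norm_le hp f
  refine ⟨⟨?_, ?_⟩, ?_, ?_⟩ <;> linarith

end CanonicalCommutation

theorem exists_linearMap_mem_graph {R E F : Type*} [Ring R] [AddCommGroup E] [Module R E]
    [AddCommGroup F] [Module R F] {A : E →ₗ.[R] F} {D : Submodule R E} {D' : Submodule R F}
    (h : ∀ v ∈ D, ∃ w ∈ D', (v, w) ∈ A.graph) :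
    ∃ T : D →ₗ[R] D', ∀ v : D, ((v : E), (T v : F)) ∈ A.graph := by
  have hdom : D ≤ A.domain := fun v hv =>
    let ⟨_, _, hw⟩ := h v hv
    LinearPMap.mem_domain_of_mem_graph hw
  have hgraph (v : D) : ((v : E), A (Submodule.inclusion hdom v)) ∈ A.graph :=
    LinearPMap.mem_graph A (Submodule.inclusion hdom v)
  refine ⟨(A.toFun ∘ₗ Submodule.inclusion hdom).codRestrict D' fun v => ?_, hgraph⟩
  obtain ⟨w, hwD, hw⟩ := h v v.2
  obtain rfl := LinearPMap.mem_graph_snd_inj _ hw (hgraph v) rfl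
  exact hwD

variable {H : Type*} [NormedAddCommGroup H] [InnerProductSpace ℂ H] {A B : H →ₗ.[ℂ] H}

theorem isFormalAdjoint_opMul_self (h : A.IsFormalAdjoint A) :
    (opMul A A).IsFormalAdjoint (opMul A A) := by
  refine isFormalAdjoint_iff_graph.2 fun v w hvw v' w' hvw' => ?_
  obtain ⟨u, hvu, huw⟩ := mem_graph_opMul_iff.1 hvw
  obtain ⟨u', hvu', huw'⟩ := mem_graph_opMul_iff.1 hvw'
  rw [isFormalAdjoint_iff_graph] at h
  rw [h _ _ huw _ _ hvu', h _ _ hvu _ _ huw']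

theorem mem_graph_opMul_add_opMul_iff {v w : H} : (v, w) ∈ (opMul A A + opMul B B).graph ↔
    ∃ a aa b bb, ((v, a) ∈ A.graph ∧ (a, aa) ∈ A.graph) ∧
      ((v, b) ∈ B.graph ∧ (b, bb) ∈ B.graph) ∧ aa + bb = w := by
  simp only [mem_graph_add_iff, mem_graph_opMul_iff]
  constructor
  · rintro ⟨aa, bb, ⟨a, ha⟩, ⟨b, hb⟩, h⟩
    exact ⟨a, aa, b, bb, ha, hb, h⟩
  · rintro ⟨a, aa, b, bb, ha, hb, h⟩
    exact ⟨aa, bb, ⟨a, ha⟩, ⟨b, hb⟩, h⟩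

theorem exists_tendsto_mem_graph_sq [CompleteSpace H] (hA : A.IsClosed) {v a aa : ℕ → H} {v₀ : H}
    (h : ∀ n, (v n, a n) ∈ A.graph ∧ (a n, aa n) ∈ A.graph) (hv : Tendsto v atTop (𝓝 v₀))
    (ha : CauchySeq a) (haa : CauchySeq aa) :
    ∃ a₀ aa₀, Tendsto aa atTop (𝓝 aa₀) ∧ (v₀, a₀) ∈ A.graph ∧ (a₀, aa₀) ∈ A.graph := by
  obtain ⟨a₀, ha⟩ := cauchySeq_tendsto_of_complete ha
  obtain ⟨aa₀, haa⟩ := cauchySeq_tendsto_of_complete haa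
  exact ⟨a₀, aa₀, haa,
    hA.mem_of_tendsto (hv.prodMk_nhds ha) (Eventually.of_forall fun n => (h n).1),
    hA.mem_of_tendsto (ha.prodMk_nhds haa) (Eventually.of_forall fun n => (h n).2)⟩

theorem topologicalClosure_graph_domRestrict_opMul_add_opMul_le [CompleteSpace H]
    (hA : A.IsFormalAdjoint A) (hB : B.IsFormalAdjoint B) (hA' : A.IsClosed) (hB' : B.IsClosed)
    {D : Submodule ℂ H} (hAD : ∀ v ∈ D, ∃ w ∈ D, (v, w) ∈ A.graph)
    (hBD : ∀ v ∈ D, ∃ w ∈ D, (v, w) ∈ B.graph)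
    (hcomm : ∀ v a b d, (v, a) ∈ A.graph → (v, b) ∈ B.graph → (b, d) ∈ A.graph →
      (a, d - Complex.I • v) ∈ B.graph) :
    ((opMul A A + opMul B B).domRestrict D).graph.topologicalClosure ≤
      (opMul A A + opMul B B).graph := by
  obtain ⟨q, hq⟩ := exists_linearMap_mem_graph hAD
  obtain ⟨p, hp⟩ := exists_linearMap_mem_graph hBD
  have hbound := norm_le_mul_norm_prod_of_commutator
    (fun f g => isFormalAdjoint_iff_graph.1 hA _ _ (hq f) _ _ (hq g) : q.IsSymmetric)
    (fun f g => isFormalAdjoint_iff_graph.1 hB _ _ (hp f) _ _ (hp g) : p.IsSymmetric)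
    fun f => Subtype.ext <| LinearPMap.mem_graph_snd_inj _ (hp (q f))
      (hcomm _ _ _ _ (hq f) (hp f) (hq (p f))) rfl
  rintro ⟨v₀, w₀⟩ h₀
  obtain ⟨x, hx, hlim⟩ := mem_closure_iff_seq_limit.1 h₀
  have hv : Tendsto (fun n => (x n).1) atTop (𝓝 v₀) := (continuous_fst.tendsto _).comp hlim
  have hw : Tendsto (fun n => (x n).2) atTop (𝓝 w₀) := (continuous_snd.tendsto _).comp hlim
  have hxD (n : ℕ) : (x n).1 ∈ D := (mem_graph_domRestrict_iff.1 (hx n)).1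
  let f (n : ℕ) : D := ⟨(x n).1, hxD n⟩
  have hxw (n : ℕ) : (x n).2 = q (q (f n)) + p (p (f n)) :=
    LinearPMap.mem_graph_snd_inj _ (mem_graph_domRestrict_iff.1 (hx n)).2
      (mem_graph_opMul_add_opMul_iff.2
        ⟨_, _, _, _, ⟨hq (f n), hq _⟩, ⟨hp (f n), hp _⟩, rfl⟩) rfl
  have hcauchy {T : D →ₗ[ℂ] D} (hT : ∀ f, ‖T f‖ ≤ 3 * ‖(f, q (q f) + p (p f))‖) :
      CauchySeq fun n => (T (f n) : H) := by
    refine cauchySeq_comp_of_norm_le (a := (D.subtype ∘ₗ T).toAddMonoidHom) (K := 3)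
      (b := (D.subtype.prod (D.subtype ∘ₗ (q ∘ₗ q + p ∘ₗ p))).toAddMonoidHom) hT
      (u := f) ?_
    have hlim' : Tendsto (fun n => ((f n : H), (q (q (f n)) + p (p (f n)) : H))) atTop _ :=
      hlim.congr fun n => congrArg (Prod.mk (x n).1) (hxw n)
    exact hlim'.cauchySeq
  obtain ⟨a, aa, haa, ha⟩ := exists_tendsto_mem_graph_sq hA' (fun n => ⟨hq (f n), hq (q (f n))⟩)
    hv (hcauchy fun f => (hbound f).1.1) (hcauchy (T := q ∘ₗ q) fun f => (hbound f).1.2)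
  obtain ⟨b, bb, hbb, hb⟩ := exists_tendsto_mem_graph_sq hB' (fun n => ⟨hp (f n), hp (p (f n))⟩)
    hv (hcauchy fun f => (hbound f).2.1) (hcauchy (T := p ∘ₗ p) fun f => (hbound f).2.2)
  refine mem_graph_opMul_add_opMul_iff.2 ⟨a, aa, b, bb, ha, hb, ?_⟩
  exact tendsto_nhds_unique (haa.add hbb) (hw.congr hxw)

end SumOfSquares

/-! ### Gaussian and coherent vectors -/

section Analysis

open scoped FourierTransform ComplexConjugate

theorem ae_eq_zero_of_fourier_eq_zero {V F : Type*} [NormedAddCommGroup V] [InnerProductSpace ℝ V]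
    [FiniteDimensional ℝ V] [MeasurableSpace V] [BorelSpace V] [NormedAddCommGroup F]
    [NormedSpace ℂ F] [CompleteSpace F] {f : V → F} (hf : Integrable f) (h : 𝓕 f = 0) :
    f =ᵐ[volume] 0 := by
  refine ae_eq_zero_of_integral_contDiff_smul_eq_zero hf.locallyIntegrable fun g hg hc => ?_
  let G : SchwartzMap V ℂ := (hc.comp_left (g := ((↑) : ℝ → ℂ)) (by simp)).toSchwartzMap
    (Complex.ofRealCLM.contDiff.comp hg)
  let K : SchwartzMap V ℂ := 𝓕⁻ G
  have hK : 𝓕 ⇑K = G := by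
    rw [← SchwartzMap.fourier_coe, FourierTransform.fourier_fourierInv_eq]
  calc ∫ x, g x • f x
      = ∫ x, 𝓕 ⇑K x • f x := by
        rw [hK]
        exact integral_congr_ae (Eventually.of_forall fun x => (Complex.coe_smul (g x) (f x)).symm)
    _ = ∫ x, K x • 𝓕 f x := by
        simpa using! VectorFourier.integral_fourierIntegral_smul_eq_flip (L := innerₗ V)
          (μ := volume) (ν := volume) Real.continuous_fourierChar continuous_inner K.integrable hf
    _ = 0 := by simp [h]

theorem hasDerivAt_of_ae_norm_sub_le {𝕜 α E F : Type*} [NontriviallyNormedField 𝕜]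
    [NormedAddCommGroup E] [NormedSpace 𝕜 E] [NormedAddCommGroup F] {m : MeasurableSpace α}
    {μ : Measure α} {p : ℝ≥0∞} [Fact (1 ≤ p)] {f : 𝕜 → Lp E p μ} {f' : Lp E p μ} {z : 𝕜}
    {G : α → F} (hG : MemLp G p μ)
    (h : ∀ᶠ w in 𝓝 z, ∀ᵐ x ∂μ, ‖f w x - f z x - (w - z) • f' x‖ ≤ ‖w - z‖ ^ 2 * ‖G x‖) :
    HasDerivAt f f' z := by
  have hO : (fun w => f w - f z - (w - z) • f') =O[𝓝 z] fun w => ‖w - z‖ ^ 2 := by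
    refine Asymptotics.IsBigO.of_bound ‖hG.toLp‖ ?_
    filter_upwards [h] with w hw
    rw [norm_pow, norm_norm, mul_comm]
    refine Lp.norm_le_mul_norm_of_ae_le_mul ?_
    filter_upwards [hw, hG.coeFn_toLp, Lp.coeFn_sub (f w - f z) ((w - z) • f'),
      Lp.coeFn_sub (f w) (f z), Lp.coeFn_smul (w - z) f'] with x hx hGx hsub hsub' hsmul
    simpa only [hsub, hsub', hsmul, hGx, Pi.sub_apply, Pi.smul_apply] using hx
  exact hasDerivAt_iff_isLittleO.2 (hO.trans_isLittleO
    (Asymptotics.isLittleO_pow_sub_sub z one_lt_two))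

theorem norm_cexp_sub_one_sub_le (w : ℂ) :
    ‖Complex.exp w - 1 - w‖ ≤ ‖w‖ ^ 2 * Real.exp ‖w‖ := by
  simpa [Finset.sum_range_succ, sub_sub] using Complex.norm_exp_sub_sum_le_norm_mul_exp w 2

theorem norm_cexp_mul_sub_le {h : ℂ} (hh : ‖h‖ ≤ 1) (x : ℝ) :
    ‖Complex.exp (h * x) - 1 - h * x‖ ≤ ‖h‖ ^ 2 * (2 * Real.exp (2 * |x|)) := by
  have hx : |x| ^ 2 ≤ 2 * Real.exp |x| := by
    have := Real.pow_div_factorial_le_exp |x| (abs_nonneg x) 2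
    rwa [div_le_iff₀ (by positivity), Nat.factorial_two, Nat.cast_two, mul_comm] at this
  calc ‖Complex.exp (h * x) - 1 - h * x‖
      ≤ ‖h * x‖ ^ 2 * Real.exp ‖h * x‖ := norm_cexp_sub_one_sub_le _
    _ = ‖h‖ ^ 2 * (|x| ^ 2 * Real.exp (‖h‖ * |x|)) := by
        rw [norm_mul, Complex.norm_real, Real.norm_eq_abs]; ring
    _ ≤ ‖h‖ ^ 2 * (2 * Real.exp |x| * Real.exp (1 * |x|)) := by gcongr
    _ = ‖h‖ ^ 2 * (2 * Real.exp (2 * |x|)) := by rw [two_mul |x|, Real.exp_add]; ring_nf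

theorem exp_mul_abs_le (a x : ℝ) : Real.exp (a * |x|) ≤ Real.exp (a * x) + Real.exp (-a * x) := by
  rcases abs_choice x with h | h <;> rw [h]
  · exact le_add_of_nonneg_right (Real.exp_pos _).le
  · rw [mul_neg, neg_mul]
    exact le_add_of_nonneg_left (Real.exp_pos _).le

theorem hasDerivAt_ofReal_mul_const (c : ℂ) : HasDerivAt (fun t : ℝ => (t : ℂ) * c) c 0 := by
  simpa using (Complex.ofRealCLM.hasDerivAt (x := (0 : ℝ))).mul_const c

theorem hasDerivAt_ofReal_quadratic (a b : ℂ) :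
    HasDerivAt (fun t : ℝ => (t : ℂ) ^ 2 * a + t * b) b 0 := by
  simpa using! (((Complex.ofRealCLM.hasDerivAt (x := (0 : ℝ))).pow 2).mul_const a).add
    (hasDerivAt_ofReal_mul_const b)

end Analysis

section GaussianVectors

open Polynomial
open scoped FourierTransform ComplexConjugate

/-- The function `p(x) exp (z x - x² / 2)`. -/
def gaussFun (p : ℂ[X]) (z : ℂ) (x : ℝ) : ℂ :=
  p.eval (x : ℂ) * Complex.exp (z * x - x ^ 2 / 2)

theorem continuous_gaussFun (p : ℂ[X]) (z : ℂ) : Continuous (gaussFun p z) := by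
  have := p.continuous.comp Complex.continuous_ofReal
  unfold gaussFun
  fun_prop

theorem gaussFun_add (p q : ℂ[X]) (z : ℂ) : gaussFun (p + q) z = gaussFun p z + gaussFun q z := by
  ext x; simp [gaussFun, add_mul]

theorem gaussFun_smul (c : ℂ) (p : ℂ[X]) (z : ℂ) : gaussFun (c • p) z = c • gaussFun p z := by
  ext x; simp [gaussFun, mul_assoc]

theorem gaussFun_mul (p q : ℂ[X]) (z : ℂ) (x : ℝ) :
    gaussFun (p * q) z x = p.eval (x : ℂ) * gaussFun q z x := by
  simp [gaussFun, mul_assoc]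

theorem gaussFun_add_right (p : ℂ[X]) (z h : ℂ) (x : ℝ) :
    gaussFun p (z + h) x = Complex.exp (h * x) * gaussFun p z x := by
  rw [gaussFun, gaussFun, mul_left_comm, ← Complex.exp_add]
  ring_nf

theorem conj_gaussFun_one (z : ℂ) (x : ℝ) : conj (gaussFun 1 z x) = gaussFun 1 (conj z) x := by
  simp [map_ofNat conj 2, gaussFun, ← Complex.exp_conj, Complex.conj_ofReal]

theorem gaussFun_one_ne_zero (z : ℂ) (x : ℝ) : gaussFun 1 z x ≠ 0 := by simp [gaussFun]

theorem exp_mul_abs_mul_norm_gaussFun_le (p : ℂ[X]) (z : ℂ) (a x : ℝ) :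
    Real.exp (a * |x|) * ‖gaussFun p z x‖ ≤ ‖gaussFun p (z + a) x‖ + ‖gaussFun p (z - a) x‖ := by
  have hexp (b : ℝ) : ‖Complex.exp (b * x)‖ = Real.exp (b * x) := by
    rw [← Complex.ofReal_mul, Complex.norm_exp_ofReal]
  rw [sub_eq_add_neg, ← Complex.ofReal_neg, gaussFun_add_right, gaussFun_add_right, norm_mul,
    norm_mul, hexp, hexp, ← add_mul]
  gcongr
  exact exp_mul_abs_le a x

theorem memLp_gaussFun_C (c z : ℂ) : MemLp (gaussFun (C c) z) 2 volume := by
  refine (memLp_two_iff_integrable_sq_norm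
    (continuous_gaussFun _ _).aestronglyMeasurable).2 ?_
  have h := (integrable_cexp_quadratic (b := 1) (by simp) (2 * z) 0).norm
  refine (h.const_mul (‖c‖ ^ 2)).congr (Eventually.of_forall fun x => ?_)
  simp only [gaussFun, eval_C, norm_mul, mul_pow, ← norm_pow _ 2, ← Complex.exp_nat_mul]
  ring_nf

theorem memLp_gaussFun (p : ℂ[X]) (z : ℂ) : MemLp (gaussFun p z) 2 volume := by
  induction p using Polynomial.induction_on generalizing z with
  | C c => exact memLp_gaussFun_C c z
  | add p q hp hq => rw [gaussFun_add]; exact (hp z).add (hq z)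
  | monomial n c ih =>
    refine ((ih (z + (1 : ℝ))).norm.add (ih (z - (1 : ℝ))).norm).mono
      (continuous_gaussFun _ _).aestronglyMeasurable (Eventually.of_forall fun x => ?_)
    rw [pow_succ', mul_left_comm, gaussFun_mul, eval_X, norm_mul, Complex.norm_real,
      Real.norm_eq_abs, Pi.add_apply, Real.norm_of_nonneg (by positivity)]
    refine le_trans ?_ (exp_mul_abs_mul_norm_gaussFun_le _ z 1 x)
    gcongr
    linarith [Real.add_one_le_exp (1 * |x|)]

/-- The vector `p(x) exp (z x - x² / 2)` of `L²(ℝ)`, linear in the polynomial `p`. -/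
def gaussVec (z : ℂ) : ℂ[X] →ₗ[ℂ] L2R where
  toFun p := (memLp_gaussFun p z).toLp
  map_add' p q := by
    rw [← MemLp.toLp_add]
    exact MemLp.toLp_congr _ _ (by rw [gaussFun_add])
  map_smul' c p := by
    rw [RingHom.id_apply, ← MemLp.toLp_const_smul]
    exact MemLp.toLp_congr _ _ (by rw [gaussFun_smul])

theorem coeFn_gaussVec (z : ℂ) (p : ℂ[X]) : gaussVec z p =ᵐ[volume] gaussFun p z :=
  MemLp.coeFn_toLp (memLp_gaussFun p z)

theorem hasDerivAt_gaussVec (p : ℂ[X]) (z : ℂ) :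
    HasDerivAt (fun z => gaussVec z p) (gaussVec z (X * p)) z := by
  refine hasDerivAt_of_ae_norm_sub_le (((memLp_gaussFun p (z + (2 : ℝ))).norm.add
    (memLp_gaussFun p (z - (2 : ℝ))).norm).const_mul 2) ?_
  filter_upwards [Metric.closedBall_mem_nhds z one_pos] with w hw
  filter_upwards [coeFn_gaussVec w p, coeFn_gaussVec z p, coeFn_gaussVec z (X * p)]
    with x hwx hzx hXx
  rw [mem_closedBall_iff_norm] at hw
  have hfactor : gaussFun p w x - gaussFun p z x - (w - z) • gaussFun (X * p) z x =
      (Complex.exp ((w - z) * x) - 1 - (w - z) * x) * gaussFun p z x := by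
    conv_lhs => rw [← add_sub_cancel z w, gaussFun_add_right, gaussFun_mul, eval_X]
    simp only [add_sub_cancel_left, smul_eq_mul]
    ring
  rw [hwx, hzx, hXx, hfactor, norm_mul, norm_mul, Pi.add_apply,
    Real.norm_ofNat, Real.norm_of_nonneg (add_nonneg (norm_nonneg _) (norm_nonneg _))]
  calc _ ≤ ‖w - z‖ ^ 2 * (2 * Real.exp (2 * |x|)) * ‖gaussFun p z x‖ := by
        gcongr; exact norm_cexp_mul_sub_le hw x
    _ = ‖w - z‖ ^ 2 * (2 * (Real.exp (2 * |x|) * ‖gaussFun p z x‖)) := by ring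
    _ ≤ _ := by gcongr; exact exp_mul_abs_mul_norm_gaussFun_le p z 2 x

theorem inner_gaussVec_one (z w : ℂ) : inner ℂ (gaussVec z 1) (gaussVec w 1) =
    √Real.pi * Complex.exp ((conj z + w) ^ 2 / 4) := by
  have hint : ∀ᵐ x : ℝ, inner ℂ (gaussVec z 1 x) (gaussVec w 1 x) =
      Complex.exp (-1 * x ^ 2 + (conj z + w) * x + 0) := by
    filter_upwards [coeFn_gaussVec z 1, coeFn_gaussVec w 1] with x hz hw
    rw [hz, hw, RCLike.inner_apply, conj_gaussFun_one]
    simp only [gaussFun, eval_one, one_mul, ← Complex.exp_add]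
    ring_nf
  rw [L2.inner_def, integral_congr_ae hint, integral_cexp_quadratic (by simp)]
  congr 1
  · rw [neg_neg, div_one, Real.sqrt_eq_rpow, Complex.ofReal_cpow Real.pi_pos.le]
    norm_num
  · ring_nf

theorem eq_zero_of_inner_gaussVec_one_eq_zero {v : L2R}
    (h : ∀ z, inner ℂ (gaussVec z 1) v = 0) : v = 0 := by
  have hint : Integrable (fun x => gaussFun 1 0 x * v x) :=
    (memLp_gaussFun 1 0).integrable_mul (Lp.memLp v)
  have hfourier : 𝓕 (fun x => gaussFun 1 0 x * v x) = 0 := by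
    funext y
    refine Eq.trans ?_ (h (conj (-2 * Real.pi * y * Complex.I)))
    rw [Real.fourier_real_eq_integral_exp_smul, L2.inner_def]
    refine integral_congr_ae ?_
    filter_upwards [coeFn_gaussVec (conj (-2 * Real.pi * y * Complex.I)) 1] with x hx
    rw [hx, RCLike.inner_apply, conj_gaussFun_one, Complex.conj_conj,
      ← zero_add (-2 * Real.pi * y * Complex.I), gaussFun_add_right, smul_eq_mul]
    push_cast
    ring_nf
  refine Lp.ext ?_
  filter_upwards [ae_eq_zero_of_fourier_eq_zero hint hfourier,
    Lp.coeFn_zero ℂ 2 (volume : Measure ℝ)] with x hx hx0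
  rw [hx0]
  exact (mul_eq_zero.1 hx).resolve_left (gaussFun_one_ne_zero 0 x)

/-- The coherent vectors `exp (z x - x² / 2 - z² / 4)`, normalized so that their inner products
are holomorphic in one argument and antiholomorphic in the other. -/
def coherentVec (z : ℂ) : L2R := Complex.exp (-z ^ 2 / 4) • gaussVec z 1

theorem hasDerivAt_coherentVec (z : ℂ) :
    HasDerivAt coherentVec (Complex.exp (-z ^ 2 / 4) • gaussVec z (X - C (z / 2))) z := by
  have hexp : HasDerivAt (fun z : ℂ => Complex.exp (-z ^ 2 / 4))
      (Complex.exp (-z ^ 2 / 4) * -(z / 2)) z := by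
    refine HasDerivAt.cexp ?_
    exact (((hasDerivAt_id z).pow 2).neg.div_const 4).congr_deriv (by simp; ring)
  refine (hexp.smul (hasDerivAt_gaussVec 1 z)).congr_deriv ?_
  rw [← mul_one (C (z / 2)), ← smul_eq_C_mul, mul_one X, map_sub, map_smul]
  module

theorem continuous_coherentVec : Continuous coherentVec :=
  continuous_iff_continuousAt.2 fun z => (hasDerivAt_coherentVec z).continuousAt

theorem inner_coherentVec (z w : ℂ) :
    inner ℂ (coherentVec z) (coherentVec w) = √Real.pi * Complex.exp (conj z * w / 2) := by
  rw [coherentVec, coherentVec, inner_smul_left, inner_smul_right, inner_gaussVec_one,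
    ← Complex.exp_conj, mul_left_comm (Complex.exp (-w ^ 2 / 4)), mul_left_comm,
    ← Complex.exp_add, ← Complex.exp_add]
  congr 2
  simp only [map_div₀, map_neg, map_pow, map_ofNat]
  ring

theorem coherentVec_ne_zero (z : ℂ) : coherentVec z ≠ 0 := by
  rw [← inner_self_ne_zero (𝕜 := ℂ), inner_coherentVec]
  simp [Real.sqrt_ne_zero'.2 Real.pi_pos]

/-- The linear span of the coherent vectors: a common core of all the generators below. -/
def coherentSpan : Submodule ℂ L2R := Submodule.span ℂ (Set.range coherentVec)

theorem coherentVec_mem_coherentSpan (z : ℂ) : coherentVec z ∈ coherentSpan :=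
  Submodule.subset_span ⟨z, rfl⟩

theorem eq_zero_of_inner_coherentVec_eq_zero {v : L2R}
    (h : ∀ z, inner ℂ (coherentVec z) v = 0) : v = 0 :=
  eq_zero_of_inner_gaussVec_one_eq_zero fun z => by
    simpa [coherentVec, inner_smul_left] using h z

theorem dense_coherentSpan : Dense (coherentSpan : Set L2R) := by
  rw [Submodule.dense_iff_topologicalClosure_eq_top, Submodule.topologicalClosure_eq_top_iff,
    Submodule.eq_bot_iff]
  exact fun v hv => eq_zero_of_inner_coherentVec_eq_zero fun z =>
    (Submodule.mem_orthogonal _ _).1 hv _ (coherentVec_mem_coherentSpan z)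

end GaussianVectors

/-! ### The representation -/

section Isometries

variable {𝕜 E F : Type*} [RCLike 𝕜] [NormedAddCommGroup E] [InnerProductSpace 𝕜 E]
  [NormedAddCommGroup F] [InnerProductSpace 𝕜 F]

theorem norm_linearCombination_eq_of_inner_eq {ι : Type*} {v : ι → E} {w : ι → F}
    (h : ∀ i j, inner 𝕜 (w i) (w j) = inner 𝕜 (v i) (v j)) (c : ι →₀ 𝕜) :
    ‖Finsupp.linearCombination 𝕜 w c‖ = ‖Finsupp.linearCombination 𝕜 v c‖ := by
  simp only [@norm_eq_sqrt_re_inner 𝕜, Finsupp.linearCombination_apply, Finsupp.sum, sum_inner,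
    inner_sum, inner_smul_left, inner_smul_right, h]

theorem exists_linearIsometry_of_inner_eq [CompleteSpace F] {ι : Type*} {v : ι → E} {w : ι → F}
    (hv : Dense (Submodule.span 𝕜 (Set.range v) : Set E))
    (h : ∀ i j, inner 𝕜 (w i) (w j) = inner 𝕜 (v i) (v j)) :
    ∃ U : E →ₗᵢ[𝕜] F, ∀ i, U (v i) = w i := by
  let e := Finsupp.linearCombination 𝕜 v
  let f := Finsupp.linearCombination 𝕜 w
  have he : DenseRange e := by
    rwa [← Finsupp.range_linearCombination, LinearMap.coe_range] at hv
  have hnorm (c) : ‖f c‖ = ‖e c‖ := norm_linearCombination_eq_of_inner_eq h c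
  have hU (c) : f.extendOfNorm e (e c) = f c :=
    LinearMap.extendOfNorm_eq he ⟨1, fun c => by rw [hnorm, one_mul]⟩ c
  refine ⟨⟨f.extendOfNorm e, fun x => ?_⟩, fun i => ?_⟩
  · refine he.induction_on (p := fun x => ‖f.extendOfNorm e x‖ = ‖x‖) x ?_ fun c => ?_
    · exact isClosed_eq (by fun_prop) continuous_norm
    · rw [hU, hnorm]
  · simpa [e, f] using hU (Finsupp.single i 1)

theorem continuous_linearIsometry_apply_of_dense {X : Type*} [TopologicalSpace X]
    {U : X → E →ₗᵢ[𝕜] F} {s : Set E} (hs : Dense (Submodule.span 𝕜 s : Set E))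
    (h : ∀ v ∈ s, Continuous fun x => U x v) (v : E) : Continuous fun x => U x v := by
  have hspan : ∀ w ∈ Submodule.span 𝕜 s, Continuous fun x => U x w := fun w hw => by
    induction hw using Submodule.span_induction with
    | mem w hw => exact h w hw
    | zero => simpa only [map_zero] using continuous_const
    | add a b _ _ ha hb => simp only [map_add]; exact ha.add hb
    | smul c a _ ha => simp only [map_smul]; exact ha.const_smul c
  refine continuous_of_uniform_approx_of_continuous fun u hu => ?_
  obtain ⟨ε, hε, hεu⟩ := Metric.mem_uniformity_dist.1 hu
  obtain ⟨w, hw, hwv⟩ := hs.exists_dist_lt v hε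
  exact ⟨fun x => U x w, hspan w hw, fun x => hεu ((LinearIsometry.dist_map _ _ _).trans_lt hwv)⟩

end Isometries

namespace UnitaryRep

variable {G : Type*} [Group G] [TopologicalSpace G]
  {H : Type*} [NormedAddCommGroup H] [InnerProductSpace ℂ H] [CompleteSpace H]

/-- The unitary representation given by a strongly continuous action of a group by linear
isometries. -/
def ofLinearIsometry (U : G →* (H →ₗᵢ[ℂ] H)) (hU : ∀ v, Continuous fun g => U g v) :
    UnitaryRep G H where
  toHom :=
    let V : G →* (H →L[ℂ] H) :=
      { toFun := fun g => (U g).toContinuousLinearMap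
        map_one' := by rw [map_one]; rfl
        map_mul' := fun g h => by rw [map_mul]; rfl }
    V.codRestrict (unitary (H →L[ℂ] H)) fun g =>
      ((Group.isUnit g).map V).mem_unitary_of_star_mul_self <|
        (ContinuousLinearMap.norm_map_iff_adjoint_comp_self (V g)).1 (U g).norm_map
  continuous_apply := hU

variable (π : UnitaryRep G H)

theorem op_one : π.op 1 = 1 := by
  rw [op, map_one]; rfl

theorem op_mul_apply (g h : G) (v : H) : π.op (g * h) v = π.op g (π.op h v) := by
  rw [op, map_mul]; rfl

theorem inner_op_op (g : G) (v w : H) : inner ℂ (π.op g v) (π.op g w) = inner ℂ v w :=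
  Unitary.inner_map_map _ v w

theorem isOneParameterUnitaryGroup_op_comp {γ : ℝ → G} (hγ : Continuous γ)
    (hadd : ∀ s t, γ (s + t) = γ s * γ t) : IsOneParameterUnitaryGroup fun t => π.op (γ t) where
  map_zero := by
    have h : γ 0 = 1 := by simpa using hadd 0 0
    rw [h, op_one]
  map_add_apply s t v := by rw [hadd, op_mul_apply]
  inner_map_map t := π.inner_op_op (γ t)
  continuous_apply v := (π.continuous_apply v).comp hγ

variable {π} {W : Submodule ℂ H} {ψ : H}

theorem op_mem_orthogonal (hW : ∀ g, ∀ v ∈ W, π.op g v ∈ W) (g : G) (v : H) (hv : v ∈ Wᗮ) :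
    π.op g v ∈ Wᗮ := by
  rw [Submodule.mem_orthogonal] at hv ⊢
  intro u hu
  rw [← π.inner_op_op g⁻¹, ← op_mul_apply, inv_mul_cancel, op_one, one_apply_eq_self]
  exact hv _ (hW g⁻¹ u hu)

theorem eq_top_of_cyclic_mem (hψ : Dense (Submodule.span ℂ (Set.range fun g => π.op g ψ) : Set H))
    (hclosed : IsClosed (W : Set H)) (hW : ∀ g, ∀ v ∈ W, π.op g v ∈ W) (hmem : ψ ∈ W) :
    W = ⊤ := by
  have hspan : Submodule.span ℂ (Set.range fun g => π.op g ψ) ≤ W :=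
    Submodule.span_le.2 (Set.range_subset_iff.2 fun g => hW g ψ hmem)
  rw [← SetLike.coe_set_eq, Submodule.top_coe, ← hclosed.closure_eq]
  exact (hψ.mono hspan).closure_eq

theorem op_eq_smul_of_add_mem_orthogonal (hW : ∀ g, ∀ v ∈ W, π.op g v ∈ W) {g : G} {χ : ℂ}
    {a b : H} (ha : a ∈ W) (hb : b ∈ Wᗮ) (h : π.op g (a + b) = χ • (a + b)) :
    π.op g a = χ • a := by
  have heq : π.op g a - χ • a = χ • b - π.op g b := by
    rw [sub_eq_sub_iff_add_eq_add, ← map_add, h, smul_add, add_comm]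
  rw [← sub_eq_zero]
  refine Submodule.disjoint_def.1 W.orthogonal_disjoint _
    (W.sub_mem (hW g a ha) (W.smul_mem χ ha)) ?_
  rw [heq]
  exact Wᗮ.sub_mem (Wᗮ.smul_mem χ hb) (op_mem_orthogonal hW g b hb)

theorem isIrreducible_of_unique_cyclic_eigenvector {ι : Type*} {γ : ι → G} {χ : ι → ℂ}
    (hψ : Dense (Submodule.span ℂ (Set.range fun g => π.op g ψ) : Set H)) (hne : ψ ≠ 0)
    (heig : ∀ i, π.op (γ i) ψ = χ i • ψ)
    (huniq : ∀ v, (∀ i, π.op (γ i) v = χ i • v) → ∃ c : ℂ, v = c • ψ) : π.IsIrreducible := by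
  refine ⟨⟨ψ, 0, hne⟩, fun W hclosed hW => ?_⟩
  have : CompleteSpace W := hclosed.completeSpace_coe
  obtain ⟨a, ha, b, hb, hab⟩ := W.exists_add_mem_mem_orthogonal ψ
  obtain ⟨c, rfl⟩ := huniq a fun i =>
    op_eq_smul_of_add_mem_orthogonal hW ha hb (hab ▸ heig i)
  rcases eq_or_ne c 0 with rfl | hc
  · rw [zero_smul, zero_add] at hab
    exact Or.inl <| (Submodule.orthogonal_eq_top_iff _).1 <|
      eq_top_of_cyclic_mem hψ W.isClosed_orthogonal (op_mem_orthogonal hW) (hab ▸ hb)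
  · exact Or.inr (eq_top_of_cyclic_mem hψ hclosed hW ((W.smul_mem_iff hc).1 ha))

end UnitaryRep

namespace EBar

open scoped ComplexConjugate

variable (μ : ℝ)

/-- The unit complex number by which the rotation by `φ` acts on the labels of the coherent
vectors. -/
def phase (φ : ℝ) : ℂ := Complex.exp ((Real.sign μ * φ : ℝ) * Complex.I)

/-- The displacement of the labels of the coherent vectors by the translation `(x, y)`. -/
def shift (x y : ℝ) : ℂ := √|μ| * (Real.sign μ * y - Complex.I * x)

/-- The logarithm of the scalar by which `g` multiplies the coherent vector of label `z`, besides
moving the label. The last term, half the angle, is the ground state energy `1 / 2` of the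
oscillator. -/
def logFactor (g : EBar) (z : ℂ) : ℂ :=
  -Complex.I * μ * g.s - shift μ g.ax g.ay * conj (shift μ g.ax g.ay) / 4
    - phase μ g.φ * z * conj (shift μ g.ax g.ay) / 2 + Complex.I * (Real.sign μ * g.φ) / 2

/-- The image of the coherent vector of label `z` under `g`. -/
def coherentAct (g : EBar) (z : ℂ) : L2R :=
  Complex.exp (logFactor μ g z) • coherentVec (phase μ g.φ * z + shift μ g.ax g.ay)

variable {μ}

theorem phase_add (φ ψ : ℝ) : phase μ (φ + ψ) = phase μ φ * phase μ ψ := by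
  simp only [phase, ← Complex.exp_add, ← add_mul, ← Complex.ofReal_add, ← mul_add]

theorem phase_zero : phase μ 0 = 1 := by simp [phase]

theorem phase_mul_conj (φ : ℝ) : phase μ φ * conj (phase μ φ) = 1 := by
  rw [phase, ← Complex.exp_conj, ← Complex.exp_add]
  simp

theorem sign_sq (hμ : μ ≠ 0) : (Real.sign μ : ℂ) ^ 2 = 1 := by
  rcases Real.sign_apply_eq_of_ne_zero μ hμ with h | h <;> simp [h]

theorem phase_eq_cos_add_sin (hμ : μ ≠ 0) (φ : ℝ) :
    phase μ φ = Real.cos φ + Real.sign μ * Real.sin φ * Complex.I := by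
  rw [phase, Complex.exp_mul_I, ← Complex.ofReal_cos, ← Complex.ofReal_sin]
  rcases Real.sign_apply_eq_of_ne_zero μ hμ with h | h <;> simp [h]

theorem sqrt_abs_sq_mul_sign : (√|μ| : ℂ) ^ 2 * Real.sign μ = μ := by
  rw [← Complex.ofReal_pow, Real.sq_sqrt (abs_nonneg μ), ← Complex.ofReal_mul, mul_comm]
  rcases lt_trichotomy μ 0 with h | rfl | h
  · simp [Real.sign_of_neg h, abs_of_neg h]
  · simp
  · simp [Real.sign_of_pos h, abs_of_pos h]

theorem phase_mul_shift (hμ : μ ≠ 0) (φ x y : ℝ) :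
    phase μ φ * shift μ x y = shift μ (rotX φ x y) (rotY φ x y) := by
  rw [phase_eq_cos_add_sin hμ, shift, shift, rotX, rotY]
  simp only [Complex.ofReal_add, Complex.ofReal_sub, Complex.ofReal_mul]
  linear_combination (-(√|μ| : ℂ) * Real.sin φ * x * Real.sign μ) * Complex.I_sq
    + (√|μ| : ℂ) * Complex.I * Real.sin φ * y * sign_sq hμ

theorem shift_add (x y x' y' : ℝ) : shift μ (x + x') (y + y') = shift μ x y + shift μ x' y' := by
  simp only [shift, Complex.ofReal_add]; ring

theorem shift_zero : shift μ 0 0 = 0 := by simp [shift]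

theorem conj_shift_mul_shift_sub (x y x' y' : ℝ) :
    conj (shift μ x' y') * shift μ x y - shift μ x' y' * conj (shift μ x y)
      = -2 * Complex.I * μ * (x * y' - y * x') := by
  simp only [shift, map_mul, map_sub, Complex.conj_ofReal, Complex.conj_I]
  linear_combination (-2 * Complex.I * (x * y' - y * x')) * sqrt_abs_sq_mul_sign (μ := μ)

theorem exists_shift_eq (hμ : μ ≠ 0) (z : ℂ) : ∃ x y, shift μ x y = z := by
  have hsqrt : (√|μ| : ℂ) ≠ 0 :=
    Complex.ofReal_ne_zero.2 (Real.sqrt_pos.2 (abs_pos.2 hμ)).ne'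
  refine ⟨-z.im / √|μ|, Real.sign μ * z.re / √|μ|, ?_⟩
  rw [shift]
  push_cast
  field_simp
  rw [sign_sq hμ]
  conv_rhs => rw [← Complex.re_add_im z]
  ring

theorem logFactor_mul (hμ : μ ≠ 0) (g h : EBar) (z : ℂ) : logFactor μ (g * h) z =
    logFactor μ h z + logFactor μ g (phase μ h.φ * z + shift μ h.ax h.ay) := by
  have hphase := phase_mul_conj (μ := μ) g.φ
  have hcross := conj_shift_mul_shift_sub (μ := μ) g.ax g.ay
    (rotX g.φ h.ax h.ay) (rotY g.φ h.ax h.ay)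
  simp only [logFactor, mul_def, shift_add, ← phase_mul_shift hμ, phase_add, map_add,
    map_mul] at hcross ⊢
  push_cast
  linear_combination (-(shift μ h.ax h.ay * conj (shift μ h.ax h.ay)) / 4
    - phase μ h.φ * z * conj (shift μ h.ax h.ay) / 2) * hphase - hcross / 4

theorem inner_coherentAct (g : EBar) (z w : ℂ) :
    inner ℂ (coherentAct μ g z) (coherentAct μ g w) =
      inner ℂ (coherentVec z) (coherentVec w) := by
  rw [coherentAct, coherentAct, inner_smul_left, inner_smul_right, inner_coherentVec,
    inner_coherentVec, mul_left_comm (Complex.exp _), mul_left_comm, ← Complex.exp_conj,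
    ← Complex.exp_add, ← Complex.exp_add]
  congr 2
  simp only [logFactor, map_add, map_sub, map_mul, map_neg, map_div₀, Complex.conj_I,
    Complex.conj_ofReal, Complex.conj_conj, map_ofNat]
  linear_combination (conj z * w / 2) * phase_mul_conj (μ := μ) g.φ

theorem exists_linearIsometry_coherentVec (μ : ℝ) (g : EBar) :
    ∃ U : L2R →ₗᵢ[ℂ] L2R, ∀ z, U (coherentVec z) = coherentAct μ g z :=
  exists_linearIsometry_of_inner_eq dense_coherentSpan (inner_coherentAct g)

variable (μ) in
/-- The operator by which `g` acts, as a linear isometry. -/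
def repIsometry (g : EBar) : L2R →ₗᵢ[ℂ] L2R := (exists_linearIsometry_coherentVec μ g).choose

theorem repIsometry_coherentVec (g : EBar) (z : ℂ) :
    repIsometry μ g (coherentVec z) = coherentAct μ g z :=
  (exists_linearIsometry_coherentVec μ g).choose_spec z

theorem linearIsometry_ext_coherentVec {A B : L2R →ₗᵢ[ℂ] L2R}
    (h : ∀ z, A (coherentVec z) = B (coherentVec z)) : A = B :=
  LinearIsometry.toContinuousLinearMap_injective <|
    ContinuousLinearMap.ext_on dense_coherentSpan (Set.forall_mem_range.2 h)

theorem repIsometry_one : repIsometry μ 1 = 1 :=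
  linearIsometry_ext_coherentVec fun z => by
    rw [repIsometry_coherentVec, coherentAct]
    simp [logFactor, one_def, shift_zero, phase_zero]

theorem repIsometry_mul (hμ : μ ≠ 0) (g h : EBar) :
    repIsometry μ (g * h) = repIsometry μ g * repIsometry μ h :=
  linearIsometry_ext_coherentVec fun z => by
    rw [LinearIsometry.coe_mul, Function.comp_apply, repIsometry_coherentVec,
      repIsometry_coherentVec, coherentAct, coherentAct, map_smul, repIsometry_coherentVec,
      coherentAct, smul_smul, ← Complex.exp_add, logFactor_mul hμ]
    congr 2
    simp only [mul_def, shift_add, ← phase_mul_shift hμ, phase_add]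
    ring

theorem continuous_repIsometry_apply (v : L2R) : Continuous fun g => repIsometry μ g v := by
  refine continuous_linearIsometry_apply_of_dense dense_coherentSpan
    (Set.forall_mem_range.2 fun z => ?_) v
  simp only [repIsometry_coherentVec, coherentAct, logFactor, phase, shift]
  have := continuous_s
  have := continuous_ax
  have := continuous_ay
  have := continuous_angle
  have := continuous_coherentVec
  fun_prop

/-- The representation `π̃_μ` of `Ē(2)` on `L²(ℝ)` with central charge `μ`. -/
def rep (hμ : μ ≠ 0) : UnitaryRep EBar L2R :=
  .ofLinearIsometry
    { toFun := repIsometry μ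
      map_one' := repIsometry_one
      map_mul' := repIsometry_mul hμ }
    continuous_repIsometry_apply

theorem rep_op_coherentVec (hμ : μ ≠ 0) (g : EBar) (z : ℂ) :
    (rep hμ).op g (coherentVec z) = coherentAct μ g z :=
  repIsometry_coherentVec g z

theorem rep_op_mem_coherentSpan (hμ : μ ≠ 0) (g : EBar) {v : L2R} (hv : v ∈ coherentSpan) :
    (rep hμ).op g v ∈ coherentSpan := by
  suffices h : coherentSpan ≤ coherentSpan.comap ((rep hμ).op g).toLinearMap from h hv
  refine Submodule.span_le.2 (Set.range_subset_iff.2 fun z => ?_)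
  rw [SetLike.mem_coe, Submodule.mem_comap, ContinuousLinearMap.coe_coe, rep_op_coherentVec]
  exact coherentSpan.smul_mem _ (coherentVec_mem_coherentSpan _)

end EBar

theorem eq_apply_zero_of_rotation_invariant {E : Type*} [NormedAddCommGroup E] [NormedSpace ℂ E]
    [CompleteSpace E] {F : ℂ → E} (hF : Differentiable ℂ F)
    (hrot : ∀ (θ : ℝ) z, F (Complex.exp (θ * Complex.I) * z) = F z) (z : ℂ) : F z = F 0 := by
  have hsphere : ∀ w ∈ Metric.sphere 0 |‖z‖|, F w = F z := fun w hw => by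
    rw [mem_sphere_zero_iff_norm, abs_norm] at hw
    rw [← Complex.norm_mul_exp_arg_mul_I w, ← Complex.norm_mul_exp_arg_mul_I z, hw,
      mul_comm, hrot, mul_comm, hrot]
  rw [← Real.circleAverage_const_on_circle hsphere, hF.diffContOnCl.circleAverage]

namespace EBar

open scoped ComplexConjugate

variable {μ : ℝ}

theorem rep_op_expJ_coherentVec (hμ : μ ≠ 0) (φ : ℝ) (z : ℂ) :
    (rep hμ).op (expJ φ) (coherentVec z) =
      Complex.exp (Complex.I * (Real.sign μ * φ) / 2) • coherentVec (phase μ φ * z) := by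
  rw [rep_op_coherentVec, coherentAct]
  simp [logFactor, expJ, shift_zero]

theorem inner_coherentVec_phase_mul (hμ : μ ≠ 0) {v : L2R} (hv : ∀ φ,
    (rep hμ).op (expJ φ) v = Complex.exp (Complex.I * (Real.sign μ * φ) / 2) • v) (φ : ℝ) (z : ℂ) :
    inner ℂ v (coherentVec (phase μ φ * z)) = inner ℂ v (coherentVec z) := by
  have h := (rep hμ).inner_op_op (expJ φ) v (coherentVec z)
  rw [hv, rep_op_expJ_coherentVec, inner_smul_left, inner_smul_right, ← Complex.exp_conj,
    ← mul_assoc, ← Complex.exp_add] at h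
  have hcancel : conj (Complex.I * (Real.sign μ * φ) / 2) + Complex.I * (Real.sign μ * φ) / 2
      = 0 := by
    simp only [map_div₀, map_mul, Complex.conj_I, Complex.conj_ofReal, map_ofNat]
    ring
  rwa [hcancel, Complex.exp_zero, one_mul] at h

theorem exists_eq_smul_coherentVec_zero (hμ : μ ≠ 0) {v : L2R} (hv : ∀ φ,
    (rep hμ).op (expJ φ) v = Complex.exp (Complex.I * (Real.sign μ * φ) / 2) • v) :
    ∃ c : ℂ, v = c • coherentVec 0 := by
  have hdiff : Differentiable ℂ fun z => inner ℂ v (coherentVec z) := fun z =>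
    ((innerSL ℂ v).hasFDerivAt.comp_hasDerivAt z (hasDerivAt_coherentVec z)).differentiableAt
  have hconst := eq_apply_zero_of_rotation_invariant hdiff fun θ z => by
    rw [← inner_coherentVec_phase_mul hμ hv (Real.sign μ * θ) z, phase, ← mul_assoc (Real.sign μ),
      ← sq, show Real.sign μ ^ 2 = 1 by exact_mod_cast sign_sq hμ, one_mul]
  have hpi : (√Real.pi : ℂ) ≠ 0 := Complex.ofReal_ne_zero.2 (Real.sqrt_pos.2 Real.pi_pos).ne'
  refine ⟨conj (inner ℂ v (coherentVec 0)) / √Real.pi, ?_⟩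
  rw [← sub_eq_zero]
  refine eq_zero_of_inner_coherentVec_eq_zero fun z => ?_
  rw [inner_sub_right, inner_smul_right, inner_coherentVec, mul_zero, zero_div, Complex.exp_zero,
    mul_one, div_mul_cancel₀ _ hpi, ← inner_conj_symm, hconst z, sub_self]

theorem dense_span_orbit_coherentVec_zero (hμ : μ ≠ 0) :
    Dense (Submodule.span ℂ (Set.range fun g => (rep hμ).op g (coherentVec 0)) : Set L2R) := by
  have hle : coherentSpan ≤ Submodule.span ℂ (Set.range fun g => (rep hμ).op g (coherentVec 0)) :=
    Submodule.span_le.2 (Set.range_subset_iff.2 fun z => by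
      obtain ⟨x, y, rfl⟩ := exists_shift_eq hμ z
      rw [SetLike.mem_coe,
        ← Submodule.smul_mem_iff _ (Complex.exp_ne_zero (logFactor μ ⟨0, x, y, 0⟩ 0))]
      refine Submodule.subset_span ⟨⟨0, x, y, 0⟩, ?_⟩
      simp only [rep_op_coherentVec, coherentAct, mul_zero, zero_add])
  exact dense_coherentSpan.mono hle

theorem rep_isIrreducible (hμ : μ ≠ 0) : (rep hμ).IsIrreducible :=
  UnitaryRep.isIrreducible_of_unique_cyclic_eigenvector (dense_span_orbit_coherentVec_zero hμ)
    (coherentVec_ne_zero 0) (fun φ => by rw [rep_op_expJ_coherentVec, mul_zero])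
    fun _ => exists_eq_smul_coherentVec_zero hμ

end EBar

/-! ### Position and momentum on Gaussian vectors -/

theorem tendsto_integral_comp_mul_smul {E : Type*} [NormedAddCommGroup E] [NormedSpace ℝ E]
    {φ : ℝ → ℝ} (hφ : Continuous φ) {C : ℝ} (hC : ∀ x, ‖φ x‖ ≤ C) {f : ℝ → E}
    (hf : Integrable f) :
    Tendsto (fun ε => ∫ x, φ (ε * x) • f x) (𝓝 0) (𝓝 (φ 0 • ∫ x, f x)) := by
  have hcont (x : ℝ) : Continuous fun ε => φ (ε * x) • f x := by fun_prop
  rw [← integral_smul]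
  refine tendsto_integral_filter_of_dominated_convergence (fun x => C * ‖f x‖)
    (Eventually.of_forall fun ε => ?_) (Eventually.of_forall fun ε => ae_of_all _ fun x => ?_)
    (hf.norm.const_mul C) (ae_of_all _ fun x => ?_)
  · exact (by fun_prop : Continuous fun x => φ (ε * x)).aestronglyMeasurable.smul
      hf.aestronglyMeasurable
  · exact (norm_smul _ _).trans_le (mul_le_mul_of_nonneg_right (hC _) (norm_nonneg _))
  · simpa only [zero_mul] using (hcont x).tendsto 0

theorem integrable_smul_of_memLp_two {f : ℝ → ℝ} (hf : MemLp f 2 volume) (u : L2R) :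
    Integrable fun x => f x • u x :=
  memLp_one_iff_integrable.1 ((Lp.memLp u).smul hf)

theorem mem_positionOp_graph {v w : L2R} :
    (v, w) ∈ positionOp.graph ↔ ∀ᵐ x : ℝ, w x = x * v x := by
  rw [LinearPMap.mem_graph_iff]
  constructor
  · rintro ⟨⟨_, hv⟩, rfl, rfl : positionOp ⟨_, hv⟩ = w⟩
    exact MemLp.coeFn_toLp hv
  · intro h
    have hv : MemLp (fun x : ℝ => (x : ℂ) * v x) 2 volume := (memLp_congr_ae h).1 (Lp.memLp w)
    exact ⟨⟨v, hv⟩, rfl, Lp.ext ((MemLp.coeFn_toLp hv).trans (EventuallyEq.symm h))⟩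

theorem mem_momentumOp_graph {v w : L2R} :
    (v, w) ∈ momentumOp.graph ↔ IsWeakDeriv v (Complex.I • w) := by
  have hIw : w = -Complex.I • Complex.I • w := by simp [smul_smul]
  rw [LinearPMap.mem_graph_iff]
  constructor
  · rintro ⟨⟨_, hv⟩, rfl, h : -Complex.I • Classical.choose hv = w⟩
    have hspec := Classical.choose_spec hv
    rw [← h, smul_smul]
    simpa using hspec
  · intro h
    refine ⟨⟨v, _, h⟩, rfl, ?_⟩
    change -Complex.I • Classical.choose (p := fun w => IsWeakDeriv v w) ⟨_, h⟩ = w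
    rw [(Classical.choose_spec (p := fun w => IsWeakDeriv v w) ⟨_, h⟩).unique h, ← hIw]

theorem isFormalAdjoint_positionOp : positionOp.IsFormalAdjoint positionOp := by
  refine isFormalAdjoint_iff_graph.2 fun v w h v' w' h' => ?_
  rw [L2.inner_def, L2.inner_def]
  refine integral_congr_ae ?_
  filter_upwards [mem_positionOp_graph.1 h, mem_positionOp_graph.1 h'] with x hw hw'
  rw [hw, hw']
  simp only [RCLike.inner_apply, map_mul, Complex.conj_ofReal]
  ring

theorem isClosed_positionOp : positionOp.IsClosed := by
  refine IsSeqClosed.isClosed fun u a hu ha => ?_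
  have hv := (continuous_fst.tendsto a).comp ha
  have hw := (continuous_snd.tendsto a).comp ha
  obtain ⟨k, hk, hvk⟩ := (tendstoInMeasure_of_tendsto_Lp hv).exists_seq_tendsto_ae
  obtain ⟨l, hl, hwl⟩ := (tendstoInMeasure_of_tendsto_Lp
    (hw.comp hk.tendsto_atTop)).exists_seq_tendsto_ae
  refine mem_positionOp_graph.2 ?_
  filter_upwards [hvk, hwl, ae_all_iff.2 fun n => mem_positionOp_graph.1 (hu n)] with x hvx hwx hx
  refine tendsto_nhds_unique hwx (((hvx.comp hl.tendsto_atTop).const_mul (x : ℂ)).congr fun n => ?_)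
  exact (hx (k (l n))).symm

theorem continuous_integral_test_smul {g : ℝ → ℝ} (hg : Continuous g) (hc : HasCompactSupport g) :
    Continuous fun v : L2R => ∫ x, g x • v x := by
  have hG : MemLp (fun x => (g x : ℂ)) 2 volume :=
    (hg.memLp_of_hasCompactSupport (p := 2) hc).ofReal
  have h : (fun v : L2R => ∫ x, g x • v x) = fun v => inner ℂ hG.toLp v := by
    funext v
    rw [L2.inner_def]
    refine integral_congr_ae ?_
    filter_upwards [hG.coeFn_toLp] with x hx
    rw [hx, RCLike.inner_apply, Complex.conj_ofReal, Complex.real_smul, mul_comm]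
  exact h ▸ by fun_prop

theorem isClosed_momentumOp : momentumOp.IsClosed := by
  have hgraph : (momentumOp.graph : Set (L2R × L2R)) =
      ⋂ (g : ℝ → ℝ) (_ : ContDiff ℝ ∞ g) (_ : HasCompactSupport g),
        {u | ∫ x, deriv g x • u.1 x = -∫ x, g x • (Complex.I • u.2 : L2R) x} := by
    ext u
    simp only [Set.mem_iInter]
    exact mem_momentumOp_graph
  unfold LinearPMap.IsClosed
  rw [hgraph]
  refine isClosed_iInter fun g => isClosed_iInter fun hg => isClosed_iInter fun hc => ?_
  refine isClosed_eq
    ((continuous_integral_test_smul (hg.continuous_deriv (by simp)) hc.deriv).comp continuous_fst)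
    (Continuous.neg (f := fun u : L2R × L2R => ∫ x, g x • (Complex.I • u.2 : L2R) x) ?_)
  exact (continuous_integral_test_smul hg.continuous hc).comp (continuous_snd.const_smul Complex.I)

namespace IsWeakDeriv

variable {v w : L2R}

theorem integral_cutoff_mul_deriv_smul (h : IsWeakDeriv v w) {χ g : ℝ → ℝ}
    (hχ : ContDiff ℝ ∞ χ) (hχc : HasCompactSupport χ) (hg : ContDiff ℝ ∞ g)
    (hg2 : MemLp g 2 volume) (hg2' : MemLp (deriv g) 2 volume) {ε : ℝ} (hε : ε ≠ 0) :
    ε * (∫ x, deriv χ (ε * x) • g x • v x) + ∫ x, χ (ε * x) • deriv g x • v x =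
      -∫ x, χ (ε * x) • g x • w x := by
  have hderiv (x : ℝ) : deriv (fun x => χ (ε * x) * g x) x =
      ε * (deriv χ (ε * x) * g x) + χ (ε * x) * deriv g x := by
    have hχε : Differentiable ℝ fun x => χ (ε * x) :=
      (hχ.differentiable (by simp)).comp (differentiable_id.const_mul ε)
    rw [deriv_fun_mul (hχε x) (hg.differentiable (by simp) x), deriv_comp_mul_left, smul_eq_mul,
      mul_assoc]
  have htest := h (fun x => χ (ε * x) * g x) ((hχ.comp (contDiff_const.mul contDiff_id)).mul hg)
    (hχc.comp_homeomorph (Homeomorph.mulLeft₀ ε hε)).mul_right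
  have hcont := hχ.continuous
  have hcont' : Continuous (deriv χ) := hχ.continuous_deriv (by simp)
  obtain ⟨B, hB⟩ := hχc.exists_bound_of_continuous hcont
  obtain ⟨C, hC⟩ := hχc.deriv.exists_bound_of_continuous hcont'
  have hint' : Integrable fun x => deriv χ (ε * x) • g x • v x :=
    (integrable_smul_of_memLp_two hg2 v).bdd_smul C (by fun_prop) (ae_of_all _ fun x => hC _)
  have hint : Integrable fun x => χ (ε * x) • deriv g x • v x :=
    (integrable_smul_of_memLp_two hg2' v).bdd_smul B (by fun_prop) (ae_of_all _ fun x => hB _)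
  simp only [hderiv, add_smul, mul_smul] at htest
  rwa [integral_add (hint'.fun_smul ε) hint, integral_smul, Complex.real_smul] at htest

theorem integral_deriv_smul (h : IsWeakDeriv v w) {g : ℝ → ℝ} (hg : ContDiff ℝ ∞ g)
    (hg2 : MemLp g 2 volume) (hg2' : MemLp (deriv g) 2 volume) :
    ∫ x, deriv g x • v x = -∫ x, g x • w x := by
  let χ : ContDiffBump (0 : ℝ) := ⟨1, 2, one_pos, one_lt_two⟩
  have hχ : ContDiff ℝ ∞ χ := χ.contDiff
  have hχ0 : χ 0 = 1 := χ.eventuallyEq_one.self_of_nhds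
  have hχ1 (x : ℝ) : ‖χ x‖ ≤ 1 := (Real.norm_of_nonneg χ.nonneg).trans_le χ.le_one
  have hχ' : Continuous (deriv χ) := hχ.continuous_deriv (by simp)
  obtain ⟨C, hC⟩ := χ.hasCompactSupport.deriv.exists_bound_of_continuous hχ'
  have hlim : Tendsto (fun ε : ℝ => ε * (∫ x, deriv χ (ε * x) • g x • v x) +
      ∫ x, χ (ε * x) • deriv g x • v x) (𝓝 0) (𝓝 (∫ x, deriv g x • v x)) := by
    have hε : Tendsto (fun ε : ℝ => (ε : ℂ)) (𝓝 0) (𝓝 0) :=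
      Complex.continuous_ofReal.tendsto' _ _ rfl
    simpa [hχ0] using
      (hε.mul (tendsto_integral_comp_mul_smul hχ' hC (integrable_smul_of_memLp_two hg2 v))).add
      (tendsto_integral_comp_mul_smul χ.continuous hχ1 (integrable_smul_of_memLp_two hg2' v))
  have hlim' : Tendsto (fun ε : ℝ => -∫ x, χ (ε * x) • g x • w x) (𝓝 0)
      (𝓝 (-∫ x, g x • w x)) := by
    simpa [hχ0] using
      (tendsto_integral_comp_mul_smul χ.continuous hχ1 (integrable_smul_of_memLp_two hg2 w)).neg
  refine tendsto_nhds_unique (hlim.mono_left (nhdsWithin_le_nhds (s := {0}ᶜ)))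
    ((hlim'.mono_left nhdsWithin_le_nhds).congr' ?_)
  filter_upwards [self_mem_nhdsWithin] with ε hε
  exact (h.integral_cutoff_mul_deriv_smul hχ χ.hasCompactSupport hg hg2 hg2' hε).symm

end IsWeakDeriv

theorem integral_mul_eq_integral_re_smul_add {f : ℝ → ℂ} (hf : MemLp f 2 volume) (u : L2R) :
    ∫ x, f x * u x = (∫ x, (f x).re • u x) + Complex.I * ∫ x, (f x).im • u x := by
  have hre : Integrable fun x => (f x).re • u x := integrable_smul_of_memLp_two hf.re u
  have him : Integrable fun x => (f x).im • u x := integrable_smul_of_memLp_two hf.im u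
  rw [← integral_const_mul, ← integral_add hre (him.const_mul _)]
  congr 1 with x
  change f x * u x = (f x).re • u x + Complex.I * ((f x).im • u x)
  conv_lhs => rw [← Complex.re_add_im (f x)]
  simp only [Complex.real_smul]
  ring

theorem IsWeakDeriv.integral_deriv_mul {v w : L2R} (h : IsWeakDeriv v w) {g g' : ℝ → ℂ}
    (hg : ContDiff ℝ ∞ g) (hd : ∀ x, HasDerivAt g (g' x) x)
    (hg2 : MemLp g 2 volume) (hg2' : MemLp g' 2 volume) :
    ∫ x, g' x * v x = -∫ x, g x * w x := by
  have hre : deriv (fun x => (g x).re) = fun x => (g' x).re :=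
    funext fun x => (Complex.reCLM.hasFDerivAt.comp_hasDerivAt x (hd x)).deriv
  have him : deriv (fun x => (g x).im) = fun x => (g' x).im :=
    funext fun x => (Complex.imCLM.hasFDerivAt.comp_hasDerivAt x (hd x)).deriv
  have h_re : ∫ x, (g' x).re • v x = -∫ x, (g x).re • w x := by
    simpa only [hre] using h.integral_deriv_smul (g := fun x => (g x).re)
      (Complex.reCLM.contDiff.comp hg) hg2.re (hre ▸ hg2'.re)
  have h_im : ∫ x, (g' x).im • v x = -∫ x, (g x).im • w x := by
    simpa only [him] using h.integral_deriv_smul (g := fun x => (g x).im)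
      (Complex.imCLM.contDiff.comp hg) hg2.im (him ▸ hg2'.im)
  rw [integral_mul_eq_integral_re_smul_add hg2', integral_mul_eq_integral_re_smul_add hg2, h_re,
    h_im]
  ring

section GaussianOperators

open Polynomial
open scoped ComplexConjugate

/-- The polynomial `q` for which `q(x) exp (z x - x² / 2)` is the derivative of
`p(x) exp (z x - x² / 2)`. -/
def gaussDeriv (z : ℂ) (p : ℂ[X]) : ℂ[X] := derivative p + (C z - X) * p

theorem hasDerivAt_gaussFun (z : ℂ) (p : ℂ[X]) (x : ℝ) :
    HasDerivAt (gaussFun p z) (gaussFun (gaussDeriv z p) z x) x := by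
  have hexp : HasDerivAt (fun x : ℂ => Complex.exp (z * x - x ^ 2 / 2))
      (Complex.exp (z * x - x ^ 2 / 2) * (z - x)) x := by
    simpa using ((hasDerivAt_const_mul z).sub ((hasDerivAt_pow 2 (x : ℂ)).div_const 2)).cexp
  refine ((p.hasDerivAt (x : ℂ)).comp_ofReal.mul hexp.comp_ofReal).congr_deriv ?_
  simp only [gaussFun, gaussDeriv, eval_add, eval_mul, eval_sub, eval_C, eval_X]
  ring

theorem contDiff_gaussFun (z : ℂ) (p : ℂ[X]) : ContDiff ℝ ∞ (gaussFun p z) := by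
  have hcoe : ContDiff ℝ ∞ fun x : ℝ => (x : ℂ) := Complex.ofRealCLM.contDiff
  have heval : ContDiff ℝ ∞ fun x : ℝ => p.eval (x : ℂ) := by
    simp only [eval_eq_sum_range]
    fun_prop
  exact heval.mul ((contDiff_const.mul hcoe).sub ((hcoe.pow 2).div_const 2)).cexp

theorem gaussVec_mem_positionOp_graph (z : ℂ) (p : ℂ[X]) :
    (gaussVec z p, gaussVec z (X * p)) ∈ positionOp.graph := by
  rw [mem_positionOp_graph]
  filter_upwards [coeFn_gaussVec z p, coeFn_gaussVec z (X * p)] with x hp hXp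
  rw [hp, hXp, gaussFun_mul, eval_X]

theorem integral_smul_gaussVec (f : ℝ → ℝ) (z : ℂ) (p : ℂ[X]) :
    ∫ x, f x • gaussVec z p x = ∫ x, (f x : ℂ) * gaussFun p z x := by
  refine integral_congr_ae ?_
  filter_upwards [coeFn_gaussVec z p] with x hx
  rw [hx, Complex.real_smul]

theorem isWeakDeriv_gaussVec (z : ℂ) (p : ℂ[X]) :
    IsWeakDeriv (gaussVec z p) (gaussVec z (gaussDeriv z p)) := by
  intro g hg hc
  have hint {f : ℝ → ℝ} (hf : Continuous f) (hfc : HasCompactSupport f) (q : ℂ[X]) :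
      Integrable fun x => (f x : ℂ) * gaussFun q z x :=
    ((Complex.continuous_ofReal.comp hf).mul
      (continuous_gaussFun q z)).integrable_of_hasCompactSupport
      (hfc.comp_left (g := ((↑) : ℝ → ℂ)) Complex.ofReal_zero).mul_right
  rw [integral_smul_gaussVec, integral_smul_gaussVec, eq_neg_iff_add_eq_zero,
    ← neg_eq_iff_add_eq_zero]
  exact (integral_mul_deriv_eq_deriv_mul_of_integrable
    (fun x _ => (hg.differentiable (by simp) x).hasDerivAt.ofReal_comp)
    (fun x _ => hasDerivAt_gaussFun z p x) (hint hg.continuous hc _)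
    (hint (hg.continuous_deriv (by simp)) hc.deriv _) (hint hg.continuous hc _)).symm

theorem gaussVec_mem_momentumOp_graph (z : ℂ) (p : ℂ[X]) :
    (gaussVec z p, gaussVec z (-Complex.I • gaussDeriv z p)) ∈ momentumOp.graph := by
  rw [mem_momentumOp_graph, map_smul, smul_smul]
  simpa using isWeakDeriv_gaussVec z p

theorem inner_gaussVec_one_eq_integral (z : ℂ) (u : L2R) :
    inner ℂ (gaussVec z 1) u = ∫ x, gaussFun 1 (conj z) x * u x := by
  rw [L2.inner_def]
  refine integral_congr_ae ?_
  filter_upwards [coeFn_gaussVec z 1] with x hx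
  rw [hx, RCLike.inner_apply, conj_gaussFun_one, mul_comm]

theorem conj_gaussFun_gaussDeriv_one (z : ℂ) (x : ℝ) :
    conj (gaussFun (gaussDeriv z 1) z x) = gaussFun (gaussDeriv (conj z) 1) (conj z) x := by
  have h := conj_gaussFun_one z x
  simp only [gaussFun, eval_one, one_mul] at h
  simp only [gaussFun, gaussDeriv, map_mul, h, derivative_one, zero_add, mul_one, eval_sub, eval_C,
    eval_X, map_sub, Complex.conj_ofReal]

theorem inner_gaussVec_gaussDeriv_one (z : ℂ) (u : L2R) :
    inner ℂ (gaussVec z (gaussDeriv z 1)) u =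
      ∫ x, gaussFun (gaussDeriv (conj z) 1) (conj z) x * u x := by
  rw [L2.inner_def]
  refine integral_congr_ae ?_
  filter_upwards [coeFn_gaussVec z (gaussDeriv z 1)] with x hx
  rw [hx, RCLike.inner_apply, conj_gaussFun_gaussDeriv_one, mul_comm]

theorem inner_gaussVec_momentumOp (z : ℂ) {v w : L2R} (h : (v, w) ∈ momentumOp.graph) :
    inner ℂ (gaussVec z (-Complex.I • gaussDeriv z 1)) v = inner ℂ (gaussVec z 1) w := by
  have hparts := (mem_momentumOp_graph.1 h).integral_deriv_mul (contDiff_gaussFun (conj z) 1)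
    (hasDerivAt_gaussFun (conj z) 1) (memLp_gaussFun _ _) (memLp_gaussFun _ _)
  rw [← inner_gaussVec_gaussDeriv_one, ← inner_gaussVec_one_eq_integral, inner_smul_right]
    at hparts
  rw [map_smul, inner_smul_left, hparts, map_neg, Complex.conj_I]
  linear_combination -inner ℂ (gaussVec z 1) w * Complex.I_sq

theorem coherentVec_mem_positionOp_graph (z : ℂ) :
    (coherentVec z, Complex.exp (-z ^ 2 / 4) • gaussVec z X) ∈ positionOp.graph :=
  positionOp.graph.smul_mem _ (mul_one (X : ℂ[X]) ▸ gaussVec_mem_positionOp_graph z 1)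

theorem coherentVec_mem_momentumOp_graph (z : ℂ) :
    (coherentVec z, Complex.exp (-z ^ 2 / 4) • gaussVec z (-Complex.I • gaussDeriv z 1)) ∈
      momentumOp.graph :=
  momentumOp.graph.smul_mem _ (gaussVec_mem_momentumOp_graph z 1)

theorem isFormalAdjoint_momentumOp_domRestrict_coherentSpan :
    (momentumOp.domRestrict coherentSpan).IsFormalAdjoint momentumOp := by
  refine isFormalAdjoint_domRestrict_span (Set.forall_mem_range.2 fun z =>
    ⟨_, coherentVec_mem_momentumOp_graph z, fun v w h => ?_⟩)
  rw [coherentVec, inner_smul_left, inner_smul_left, inner_gaussVec_momentumOp z h]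

end GaussianOperators

/-! ### The generators of the representation -/

namespace EBar

open Polynomial

variable {μ : ℝ}

theorem generator_rep_eq_smul (hμ : μ ≠ 0) {γ : ℝ → EBar} (hγ : Continuous γ)
    (hadd : ∀ s t, γ (s + t) = γ s * γ t) {A : L2R →ₗ.[ℂ] L2R} {c : ℝ} (hc : c ≠ 0)
    (hcoh : ∀ z, ∃ w, (coherentVec z, w) ∈ A.graph ∧
      HasDerivAt (fun t => coherentAct μ (γ t) z) (-Complex.I • (c : ℂ) • w) 0)
    (hsymm : (A.domRestrict coherentSpan).IsFormalAdjoint A)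
    (hclosure : (A.domRestrict coherentSpan).graph.topologicalClosure ≤ A.graph) :
    generator (fun t => (rep hμ).op (γ t)) = (c : ℂ) • A := by
  have hgroup := (rep hμ).isOneParameterUnitaryGroup_op_comp hγ hadd
  have hgen (z : ℂ) : ∃ w, (coherentVec z, w) ∈ A.graph ∧
      (coherentVec z, (c : ℂ) • w) ∈ (generator fun t => (rep hμ).op (γ t)).graph := by
    obtain ⟨w, hw, hderiv⟩ := hcoh z
    refine ⟨w, hw, mem_generator_graph.2 ?_⟩
    simp only [rep_op_coherentVec]
    exact hderiv
  exact hgroup.generator_eq_smul_of_span (s := Set.range coherentVec) hc dense_coherentSpan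
    (fun v hv t => rep_op_mem_coherentSpan hμ _ hv) (Set.forall_mem_range.2 hgen) hsymm hclosure

theorem hasDerivAt_exp_smul_coherentVec {a ζ : ℝ → ℂ} {a' ζ' z : ℂ} (ha : HasDerivAt a a' 0)
    (hζ : HasDerivAt ζ ζ' 0) (ha0 : a 0 = 0) (hζ0 : ζ 0 = z) :
    HasDerivAt (fun t => Complex.exp (a t) • coherentVec (ζ t))
      (Complex.exp (-z ^ 2 / 4) • gaussVec z (ζ' • (X - C (z / 2)) + a' • 1)) 0 := by
  have hcoh : HasDerivAt (fun t => coherentVec (ζ t)) _ 0 :=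
    (hasDerivAt_coherentVec (ζ 0)).scomp (0 : ℝ) hζ
  refine (ha.cexp.smul hcoh).congr_deriv ?_
  rw [ha0, Complex.exp_zero, one_smul, one_mul, hζ0, coherentVec, map_add, map_smul, map_smul,
    smul_add, smul_comm ζ', smul_comm a']

theorem coherentAct_expE (t : ℝ) (z : ℂ) :
    coherentAct μ (expE t) z = Complex.exp (t * (-Complex.I * μ)) • coherentVec z := by
  simp only [coherentAct, logFactor, expE, phase_zero, shift_zero]
  congr 2 <;> simp; ring

theorem generator_expE (hμ : μ ≠ 0) :
    generator (fun t => (rep hμ).op (expE t)) = (μ : ℂ) • idOp := by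
  refine generator_rep_eq_smul hμ (continuous_induced_rng.2 (by
    change Continuous fun t : ℝ => (t, ((0 : ℝ), (0 : ℝ)), (0 : ℝ)); fun_prop))
    (fun s t => by simp [expE, mul_def, rotX, rotY]) hμ (fun z => ?_)
    (isFormalAdjoint_mono_left LinearPMap.domRestrict_le isFormalAdjoint_idOp)
    (topologicalClosure_graph_domRestrict_le isClosed_idOp _)
  refine ⟨coherentVec z, mem_idOp_graph.2 rfl, ?_⟩
  simp only [coherentAct_expE]
  rw [← mul_smul]
  simpa using! (hasDerivAt_ofReal_mul_const (-Complex.I * μ)).cexp.smul_const (coherentVec z)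

theorem coherentAct_expPx (t : ℝ) (z : ℂ) : coherentAct μ (expPx t) z =
    Complex.exp ((t : ℂ) ^ 2 * (-(√|μ| : ℂ) ^ 2 / 4) + t * (-z * √|μ| * Complex.I / 2)) •
      coherentVec (z + t * (-Complex.I * √|μ|)) := by
  simp only [coherentAct, logFactor, expPx, shift, phase_zero, map_mul, map_sub, Complex.conj_I,
    Complex.ofReal_zero, map_zero, Complex.conj_ofReal]
  congr 2
  · linear_combination ((√|μ| : ℂ) ^ 2 * t ^ 2 / 4) * Complex.I_sq
  · ring

theorem generator_expPx (hμ : μ ≠ 0) :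
    generator (fun t => (rep hμ).op (expPx t)) = ((√|μ| : ℝ) : ℂ) • positionOp := by
  refine generator_rep_eq_smul hμ (continuous_induced_rng.2 (by
    change Continuous fun t : ℝ => ((0 : ℝ), (t, (0 : ℝ)), (0 : ℝ)); fun_prop))
    (fun s t => by simp [expPx, mul_def, rotX, rotY]) (Real.sqrt_pos.2 (abs_pos.2 hμ)).ne'
    (fun z => ⟨_, coherentVec_mem_positionOp_graph z, ?_⟩)
    (isFormalAdjoint_mono_left LinearPMap.domRestrict_le isFormalAdjoint_positionOp)
    (topologicalClosure_graph_domRestrict_le isClosed_positionOp _)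
  simp only [coherentAct_expPx]
  refine (hasDerivAt_exp_smul_coherentVec (z := z) (hasDerivAt_ofReal_quadratic _ _)
    ((hasDerivAt_ofReal_mul_const _).const_add z) (by simp) (by simp)).congr_deriv ?_
  have hpoly : (-Complex.I * √|μ|) • (X - C (z / 2)) + (-z * √|μ| * Complex.I / 2) • 1 =
      (-Complex.I * √|μ|) • (X : ℂ[X]) := by
    rw [smul_sub, sub_add_eq_add_sub, sub_eq_iff_eq_add, add_right_inj]
    rw [← mul_one (C _), ← smul_eq_C_mul, smul_smul]
    ring_nf
  rw [hpoly, map_smul, smul_comm, mul_smul]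

theorem sign_mul_sqrt_ne_zero (hμ : μ ≠ 0) : Real.sign μ * √|μ| ≠ 0 :=
  mul_ne_zero (mt Real.sign_eq_zero_iff.1 hμ) (Real.sqrt_pos.2 (abs_pos.2 hμ)).ne'

theorem coherentAct_expPy (t : ℝ) (z : ℂ) : coherentAct μ (expPy t) z =
    Complex.exp ((t : ℂ) ^ 2 * (-((Real.sign μ * √|μ| : ℝ) : ℂ) ^ 2 / 4) +
      t * (-z * (Real.sign μ * √|μ| : ℝ) / 2)) •
      coherentVec (z + t * (Real.sign μ * √|μ| : ℝ)) := by
  simp only [coherentAct, logFactor, expPy, shift, phase_zero, map_mul, map_sub,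
    Complex.conj_ofReal, Complex.conj_I, Complex.ofReal_zero, map_zero, Complex.ofReal_mul]
  congr 2 <;> ring

theorem generator_expPy (hμ : μ ≠ 0) : generator (fun t => (rep hμ).op (expPy t)) =
    ((Real.sign μ * √|μ| : ℝ) : ℂ) • momentumOp := by
  refine generator_rep_eq_smul hμ (continuous_induced_rng.2 (by
    change Continuous fun t : ℝ => ((0 : ℝ), ((0 : ℝ), t), (0 : ℝ)); fun_prop))
    (fun s t => by simp [expPy, mul_def, rotX, rotY]) (sign_mul_sqrt_ne_zero hμ)
    (fun z => ⟨_, coherentVec_mem_momentumOp_graph z, ?_⟩)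
    isFormalAdjoint_momentumOp_domRestrict_coherentSpan
    (topologicalClosure_graph_domRestrict_le isClosed_momentumOp _)
  simp only [coherentAct_expPy]
  set κ : ℂ := ((Real.sign μ * √|μ| : ℝ) : ℂ)
  refine (hasDerivAt_exp_smul_coherentVec (z := z) (hasDerivAt_ofReal_quadratic _ _)
    ((hasDerivAt_ofReal_mul_const _).const_add z) (by simp) (by simp)).congr_deriv ?_
  have hpoly : κ • (X - C (z / 2)) + (-z * κ / 2) • 1 = -κ • gaussDeriv z 1 := by
    have hz : C z = C (z / 2) + C (z / 2) := by rw [← C_add, add_halves]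
    rw [show -z * κ / 2 = -(κ * (z / 2)) by ring]
    simp only [gaussDeriv, smul_eq_C_mul, derivative_one, hz, C_neg, C_mul]
    ring
  rw [hpoly, map_smul, map_smul]
  simp only [smul_smul]
  congr 1
  linear_combination (-(κ * Complex.exp (-z ^ 2 / 4))) * Complex.I_sq

end EBar

namespace IsWeakDeriv

theorem position_smul {v w u y : L2R} (h : IsWeakDeriv v w) (hu : (v, u) ∈ positionOp.graph)
    (hy : (w, y) ∈ positionOp.graph) : IsWeakDeriv u (y + v) := by
  intro g hg hc
  have hmul : ContDiff ℝ ∞ fun x => x * g x := contDiff_id.mul hg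
  have hmulc : HasCompactSupport fun x => x * g x := hc.mul_left
  have hderiv (x : ℝ) : deriv (fun x => x * g x) x = g x + x * deriv g x := by
    simpa using! ((hasDerivAt_id x).mul (hg.differentiable (by simp) x).hasDerivAt).deriv
  have hint : Integrable fun x => deriv (fun x => x * g x) x • v x :=
    integrable_test_smul (hmul.continuous_deriv (by simp)) hmulc.deriv v
  have hu' : ∫ x, deriv g x • u x = ∫ x, (deriv (fun x => x * g x) x • v x - g x • v x) := by
    refine integral_congr_ae ?_
    filter_upwards [mem_positionOp_graph.1 hu] with x hx
    simp only [hx, hderiv, Complex.real_smul, Complex.ofReal_add, Complex.ofReal_mul]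
    ring
  have hy' : ∫ x, (x * g x) • w x = ∫ x, g x • y x := by
    refine integral_congr_ae ?_
    filter_upwards [mem_positionOp_graph.1 hy] with x hx
    simp only [hx, Complex.real_smul, Complex.ofReal_mul]
    ring
  rw [hu', integral_sub hint (integrable_test_smul hg.continuous hc v), h _ hmul hmulc, hy',
    integral_test_add hg.continuous hc]
  ring

end IsWeakDeriv

theorem mem_momentumOp_graph_of_commutator {v a b d : L2R} (ha : (v, a) ∈ positionOp.graph)
    (hb : (v, b) ∈ momentumOp.graph) (hd : (b, d) ∈ positionOp.graph) :
    (a, d - Complex.I • v) ∈ momentumOp.graph := by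
  have h := (mem_momentumOp_graph.1 hb).position_smul ha (positionOp.graph.smul_mem Complex.I hd)
  refine mem_momentumOp_graph.2 ?_
  rwa [smul_sub, smul_smul, Complex.I_mul_I, neg_one_smul, sub_neg_eq_add]

section Oscillator

open Polynomial

/-- The span of all polynomials times complex Gaussians: a space containing the coherent states
that is invariant under both position and momentum. -/
def gaussSpan : Submodule ℂ L2R :=
  Submodule.span ℂ {v | ∃ z p, gaussVec z p = v}

theorem gaussVec_mem_gaussSpan (z : ℂ) (p : ℂ[X]) : gaussVec z p ∈ gaussSpan :=
  Submodule.subset_span ⟨z, p, rfl⟩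

theorem coherentSpan_le_gaussSpan : coherentSpan ≤ gaussSpan :=
  Submodule.span_le.2 <| Set.range_subset_iff.2 fun z =>
    gaussSpan.smul_mem _ (gaussVec_mem_gaussSpan z 1)

theorem exists_mem_gaussSpan_mem_graph {A : L2R →ₗ.[ℂ] L2R}
    (h : ∀ z p, ∃ p', (gaussVec z p, gaussVec z p') ∈ A.graph) :
    ∀ v ∈ gaussSpan, ∃ w ∈ gaussSpan, (v, w) ∈ A.graph := fun v hv => by
  obtain ⟨w, hw, hw'⟩ := exists_mem_of_mem_span
    (g := A.graph ⊓ gaussSpan.comap (LinearMap.snd ℂ L2R L2R)) (by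
      rintro _ ⟨z, p, rfl⟩
      obtain ⟨p', hp'⟩ := h z p
      exact ⟨_, hp', gaussVec_mem_gaussSpan z p'⟩) hv
  exact ⟨w, hw', hw⟩

theorem isFormalAdjoint_momentumOp : momentumOp.IsFormalAdjoint momentumOp := by
  have hgroup : IsOneParameterUnitaryGroup fun t =>
      (EBar.rep one_ne_zero).op (EBar.expPy t) :=
    (EBar.rep one_ne_zero).isOneParameterUnitaryGroup_op_comp (continuous_induced_rng.2 (by
      change Continuous fun t : ℝ => ((0 : ℝ), ((0 : ℝ), t), (0 : ℝ)); fun_prop))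
      (fun s t => by simp [EBar.expPy, EBar.mul_def, EBar.rotX, EBar.rotY])
  have h := hgroup.isFormalAdjoint_generator
  rw [EBar.generator_expPy] at h
  simpa using h

theorem isFormalAdjoint_oscillatorOp : oscillatorOp.IsFormalAdjoint oscillatorOp := by
  have h := isFormalAdjoint_smul (c := (1 / 2 : ℂ)) (isFormalAdjoint_add
    (isFormalAdjoint_opMul_self isFormalAdjoint_positionOp)
    (isFormalAdjoint_opMul_self isFormalAdjoint_momentumOp))
  rwa [map_div₀, map_one, Complex.conj_ofNat] at h

theorem topologicalClosure_graph_domRestrict_oscillatorOp_le :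
    (oscillatorOp.domRestrict coherentSpan).graph.topologicalClosure ≤ oscillatorOp.graph := by
  have hsum := topologicalClosure_graph_domRestrict_opMul_add_opMul_le (D := gaussSpan)
    isFormalAdjoint_positionOp isFormalAdjoint_momentumOp isClosed_positionOp
    isClosed_momentumOp
    (exists_mem_gaussSpan_mem_graph fun z p => ⟨_, gaussVec_mem_positionOp_graph z p⟩)
    (exists_mem_gaussSpan_mem_graph fun z p => ⟨_, gaussVec_mem_momentumOp_graph z p⟩)
    fun _ _ _ _ => mem_momentumOp_graph_of_commutator
  have hmono : ((opMul positionOp positionOp + opMul momentumOp momentumOp).domRestrict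
      coherentSpan).graph ≤ ((opMul positionOp positionOp +
        opMul momentumOp momentumOp).domRestrict gaussSpan).graph := fun _ h =>
    have ⟨hv, hvw⟩ := mem_graph_domRestrict_iff.1 h
    mem_graph_domRestrict_iff.2 ⟨coherentSpan_le_gaussSpan hv, hvw⟩
  rw [oscillatorOp, domRestrict_smul]
  exact topologicalClosure_graph_smul_le (by norm_num)
    ((Submodule.topologicalClosure_mono hmono).trans hsum)

theorem gaussVec_mem_oscillatorOp_graph (z : ℂ) :
    (gaussVec z 1, gaussVec z (C z * X + C (1 / 2 - z ^ 2 / 2))) ∈ oscillatorOp.graph := by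
  refine (mem_graph_smul_iff (by norm_num)).2 (mem_graph_opMul_add_opMul_iff.2
    ⟨_, _, _, _, ⟨gaussVec_mem_positionOp_graph z 1, gaussVec_mem_positionOp_graph z _⟩,
      ⟨gaussVec_mem_momentumOp_graph z 1, gaussVec_mem_momentumOp_graph z _⟩, ?_⟩)
  rw [← map_add, ← map_smul]
  congr 1
  have hI : (C Complex.I : ℂ[X]) * C Complex.I = -1 := by
    rw [← C_mul, Complex.I_mul_I, C_neg, C_1]
  have htwo : (C (1 / 2) : ℂ[X]) * 2 = 1 := by
    rw [← C_ofNat, ← C_mul]; norm_num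
  rw [show (1 / 2 - z ^ 2 / 2 : ℂ) = 1 / 2 * (1 - z ^ 2) by ring,
    show (1 / 2 : ℂ)⁻¹ = 2 by norm_num]
  simp only [gaussDeriv, smul_eq_C_mul, C_neg, C_mul, C_sub, C_pow, C_1, C_ofNat, derivative_mul,
    derivative_sub, derivative_neg, derivative_C, derivative_X, derivative_one, zero_add, mul_one]
  linear_combination ((C z - X) ^ 2 - 1) * hI - (1 - C z ^ 2) * htwo

theorem coherentVec_mem_oscillatorOp_graph (z : ℂ) :
    (coherentVec z, Complex.exp (-z ^ 2 / 4) •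
      gaussVec z (C z * X + C (1 / 2 - z ^ 2 / 2))) ∈ oscillatorOp.graph :=
  oscillatorOp.graph.smul_mem _ (gaussVec_mem_oscillatorOp_graph z)

end Oscillator

namespace EBar

open Polynomial

variable {μ : ℝ}

theorem coherentAct_expJ (hμ : μ ≠ 0) (t : ℝ) (z : ℂ) : coherentAct μ (expJ t) z =
    Complex.exp (t * (Complex.I * Real.sign μ / 2)) •
      coherentVec (Complex.exp (t * (Real.sign μ * Complex.I)) * z) := by
  rw [← rep_op_coherentVec hμ, rep_op_expJ_coherentVec, phase]
  congr 3
  · ring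
  · rw [Complex.ofReal_mul]
    ring_nf

theorem generator_expJ (hμ : μ ≠ 0) : generator (fun t => (rep hμ).op (expJ t)) =
    ((-Real.sign μ : ℝ) : ℂ) • oscillatorOp := by
  refine generator_rep_eq_smul hμ (continuous_induced_rng.2 (by
    change Continuous fun t : ℝ => ((0 : ℝ), ((0 : ℝ), (0 : ℝ)), t); fun_prop))
    (fun s t => by simp [expJ, mul_def, rotX, rotY])
    (neg_ne_zero.2 (mt Real.sign_eq_zero_iff.1 hμ))
    (fun z => ⟨_, coherentVec_mem_oscillatorOp_graph z, ?_⟩)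
    (isFormalAdjoint_mono_left LinearPMap.domRestrict_le isFormalAdjoint_oscillatorOp)
    topologicalClosure_graph_domRestrict_oscillatorOp_le
  simp only [coherentAct_expJ hμ]
  set σ : ℂ := ((Real.sign μ : ℝ) : ℂ)
  refine (hasDerivAt_exp_smul_coherentVec (z := z) (hasDerivAt_ofReal_mul_const _)
    ((hasDerivAt_ofReal_mul_const _).cexp.mul_const z) (by simp) (by simp)).congr_deriv ?_
  have hpoly : (σ * Complex.I * z) • (X - C (z / 2)) + (Complex.I * σ / 2) • 1 =
      (Complex.I * σ) • (C z * X + C (1 / 2 - z ^ 2 / 2)) := by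
    rw [show Complex.I * σ / 2 = Complex.I * σ * (1 / 2) by ring,
      show 1 / 2 - z ^ 2 / 2 = 1 / 2 - z * (z / 2) by ring]
    simp only [smul_eq_C_mul, C_mul, C_sub]
    ring
  simp only [Complex.ofReal_zero, zero_mul, Complex.exp_zero, one_mul, hpoly, map_smul]
  rw [smul_comm, smul_smul (-Complex.I), Complex.ofReal_neg, neg_mul_neg]

end EBar

end

theorem mainTheorem4 (μ : ℝ) (hμ : μ ≠ 0) :
    ∃ π : UnitaryRep EBar L2R,
      π.IsIrreducible ∧
      generator (fun t => π.op (EBar.expE t)) = (μ : ℂ) • idOp ∧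
      generator (fun t => π.op (EBar.expPx t)) = ((Real.sqrt |μ| : ℝ) : ℂ) • positionOp ∧
      generator (fun t => π.op (EBar.expPy t)) =
        ((Real.sign μ * Real.sqrt |μ| : ℝ) : ℂ) • momentumOp ∧
      generator (fun t => π.op (EBar.expJ t)) =
        ((-Real.sign μ : ℝ) : ℂ) • oscillatorOp := by
  exact ⟨EBar.rep hμ, EBar.rep_isIrreducible hμ, EBar.generator_expE hμ, EBar.generator_expPx hμ,
    EBar.generator_expPy hμ, EBar.generator_expJ hμ⟩
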